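/- A halfspace over $\mathbb{R}^n$ is a function $f:\mathbb{R}^n\to\{\pm1\}$ of the form $f(x)=\operatorname{sign}\bigl(w_0+\sum_{i=1}^n w_ix_i\bigr)$ with $w_0,\dots,w_n\in\mathbb{R}$, where $\operatorname{sign}(t)=1$ for $t\ge 0$ and $-1$ for $t<0$; let $\mathcal{L}_n$ be the class of all of them. Let $\mathbb{R}^n$ carry a $\sigma$-algebra that contains the Borel sets (for instance the Borel or the Lebesgue $\sigma$-algebra); distributions, functions and algorithms are understood with respect to it, and functions and algorithms are measurable. For a probability distribution $\mathcal{D}$ on $\mathbb{R}^n$ and $f:\mathbb{R}^n\to\{\pm1\}$ let $\mathrm{dist}_{\mathcal{D}}(f,\mathcal{L}_n)=\inf_{h\in\mathcal{L}_n}\Pr_{x\sim\mathcal{D}}[f(x)\ne h(x)]$. * $m^{\mathrm{test}}_\epsilon(\mathcal{L}_n)$ is the least $m$ for which there is a randomized algorithm that, for every $\mathcal{D}$ and every $f$ (both unknown to it), receives $m$ labelled examples $(x,f(x))$ with the points $x$ drawn independently from $\mathcal{D}$, and accepts with probability at least $2/3$ if $f\in\mathcal{L}_n$, and rejects with probability at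 least $2/3$ if $\mathrm{dist}_{\mathcal{D}}(f,\mathcal{L}_n)>\epsilon$. * $q^{\mathrm{tol}}_{0,\epsilon}(\mathcal{L}_n)$ is the least $q$ for which there is a randomized adaptive algorithm that, for every $\mathcal{D}$ and every $f$ (both unknown to it), makes at most $q$ requests, each of which is either a labelled example $(x,f(x))$ with a fresh $x\sim\mathcal{D}$ or a query of $f(x)$ at a point $x$ of its choice (which may depend on the previous answers), and accepts with probability at least $2/3$ if $\mathrm{dist}_{\mathcal{D}}(f,\mathcal{L}_n)=0$, and rejects with probability at least $2/3$ if $\mathrm{dist}_{\mathcal{D}}(f,\mathcal{L}_n)\ge\epsilon$. (Both numbers are $\infty$ if there is no such algorithm.) **Theorem.** There are absolute constants $\epsilon_0>0$ and $c>0$ such that for all $0<\epsilon<\epsilon_0$ and all $n\ge 2$, $$m^{\mathrm{test}}_\epsilon(\mathcal{L}_n)\ \ge\ c\,\frac{n}{\log n}\qquad\text{and}\qquad q^{\mathrm{tol}}_{0,\epsilon}(\mathcal{L}_n)\ \ge\ c\,\frac{n}{\log n}.$$ -/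

import Mathlib

open MeasureTheory
open scoped ENNReal

/-! ### Boolean functions and distances

Labels are elements of `Bool`; for `{±1}`-valued functions, `true` stands for `+1` and `false`
for `-1`. -/

/-- `dist_D(f, g)`: the probability that `f x ≠ g x` when `x ∼ D`. -/
noncomputable def labelDist {X : Type*} {𝓜 : MeasurableSpace X} (D : Measure X)
    (f g : X → Bool) : ℝ≥0∞ :=
  D {x | f x ≠ g x}

/-- `dist_D(f, H)`: the infimum of `dist_D(f, h)` over `h ∈ H`. -/
noncomputable def distToClass {X : Type*} {𝓜 : MeasurableSpace X} (D : Measure X)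
    (f : X → Bool) (H : Set (X → Bool)) : ℝ≥0∞ :=
  ⨅ h ∈ H, labelDist D f h

/-! ### Sample-based testing -/

/-- A randomized algorithm which reads `m` labelled examples and outputs one bit
(`true` is "accept"). Its internal randomness is a random seed `ω ∼ ρ`. -/
structure SampleAlgorithm {X : Type*} (𝓜 : MeasurableSpace X) (m : ℕ) where
  /-- the space of seeds -/
  Ω : Type
  [mΩ : MeasurableSpace Ω]
  /-- the law of the seed -/
  ρ : Measure Ω
  [isProb : IsProbabilityMeasure ρ]
  /-- the output bit, given the seed and the labelled examples -/
  output : Ω × (Fin m → X × Bool) → Bool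
  measurable_output : Measurable output

attribute [instance] SampleAlgorithm.mΩ SampleAlgorithm.isProb

/-- The probability that the algorithm outputs `b` when it receives `m` examples `(x, f x)` with
the `x ∼ D` independent of each other and of the seed. -/
noncomputable def SampleAlgorithm.outputProb {X : Type*} {𝓜 : MeasurableSpace X} {m : ℕ}
    (A : SampleAlgorithm 𝓜 m) (D : Measure X) (f : X → Bool) (b : Bool) : ℝ≥0∞ :=
  (A.ρ.prod (Measure.pi fun _ : Fin m => D))
    {p | A.output (p.1, fun i => (p.2 i, f (p.2 i))) = b}

/-- `A` is a distribution-free (two-sided) sample `ε`-tester for `H`. -/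
def SampleAlgorithm.IsTester {X : Type*} {𝓜 : MeasurableSpace X} {m : ℕ}
    (A : SampleAlgorithm 𝓜 m) (ε : ℝ) (H : Set (X → Bool)) : Prop :=
  ∀ (D : Measure X) [IsProbabilityMeasure D] (f : X → Bool), Measurable f →
    (f ∈ H → 2 / 3 ≤ A.outputProb D f true) ∧
    (ENNReal.ofReal ε < distToClass D f H → 2 / 3 ≤ A.outputProb D f false)

/-- `m^test_ε(H)`: the least `m` such that there is a distribution-free sample `ε`-tester for `H`
with sample complexity `m` (and `⊤` if there is none). -/
noncomputable def testSampleComplexity {X : Type*} (𝓜 : MeasurableSpace X) (ε : ℝ)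
    (H : Set (X → Bool)) : ℕ∞ :=
  ⨅ (m : ℕ) (_ : ∃ A : SampleAlgorithm 𝓜 m, A.IsTester ε H), (m : ℕ∞)

/-! ### Adaptive query testing -/

/-- A randomized adaptive algorithm which makes `q` requests and then outputs one bit. Each request
is either a sample, answered by `(x, f x)` with a fresh `x ∼ D`, or a query at a point `x` chosen
by the algorithm, answered by `(x, f x)`. Which of the two is made in step `i`, and where the query
is made, depends on the seed and on the `i` previous answers. (An algorithm that makes fewer than
`q` requests is covered: it may make further requests and ignore the answers.) -/
structure QueryAlgorithm {X : Type*} (𝓜 : MeasurableSpace X) (q : ℕ) where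
  /-- the space of seeds -/
  Ω : Type
  [mΩ : MeasurableSpace Ω]
  /-- the law of the seed -/
  ρ : Measure Ω
  [isProb : IsProbabilityMeasure ρ]
  /-- whether request `i` is a sample (`true`) or a query (`false`) -/
  wantsSample : (i : ℕ) → Ω × (Fin i → X × Bool) → Bool
  /-- the point at which request `i` is made if it is a query -/
  queryPoint : (i : ℕ) → Ω × (Fin i → X × Bool) → X
  /-- the output bit, given the seed and all the answers -/
  output : Ω × (Fin q → X × Bool) → Bool
  measurable_wantsSample : ∀ i, Measurable (wantsSample i)
  measurable_queryPoint : ∀ i, Measurable (queryPoint i)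
  measurable_output : Measurable output

attribute [instance] QueryAlgorithm.mΩ QueryAlgorithm.isProb

/-- The point at which the label is revealed in step `i`, when the seed is `ω`, the previous answers
are `past`, and `x` is the fresh sample for this step. -/
def QueryAlgorithm.point {X : Type*} {𝓜 : MeasurableSpace X} {q : ℕ} (A : QueryAlgorithm 𝓜 q)
    (ω : A.Ω) {i : ℕ} (past : Fin i → X × Bool) (x : X) : X :=
  if A.wantsSample i (ω, past) = true then x else A.queryPoint i (ω, past)

/-- The answers to the first `i` requests, when the input function is `f`, the seed is `ω`, and
`s k` is the point that is drawn if request `k` is a sample. -/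
def QueryAlgorithm.answers {X : Type*} {𝓜 : MeasurableSpace X} {q : ℕ} (A : QueryAlgorithm 𝓜 q)
    (f : X → Bool) (ω : A.Ω) (s : Fin q → X) : (i : ℕ) → i ≤ q → (Fin i → X × Bool)
  | 0, _ => fun k => k.elim0
  | i + 1, hi =>
      let past := A.answers f ω s i (Nat.le_of_succ_le hi)
      let x := A.point ω past (s ⟨i, hi⟩)
      Fin.snoc past (x, f x)

/-- The probability that the algorithm outputs `b` on input function `f` and distribution `D`. -/
noncomputable def QueryAlgorithm.outputProb {X : Type*} {𝓜 : MeasurableSpace X} {q : ℕ}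
    (A : QueryAlgorithm 𝓜 q) (D : Measure X) (f : X → Bool) (b : Bool) : ℝ≥0∞ :=
  (A.ρ.prod (Measure.pi fun _ : Fin q => D))
    {p | A.output (p.1, A.answers f p.1 p.2 q le_rfl) = b}

/-- `A` is an `(ε₁, ε₂)`-tolerant distribution-free adaptive query tester for `H`. -/
def QueryAlgorithm.IsTolerantTester {X : Type*} {𝓜 : MeasurableSpace X} {q : ℕ}
    (A : QueryAlgorithm 𝓜 q) (ε₁ ε₂ : ℝ) (H : Set (X → Bool)) : Prop :=
  ∀ (D : Measure X) [IsProbabilityMeasure D] (f : X → Bool), Measurable f →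
    (distToClass D f H ≤ ENNReal.ofReal ε₁ → 2 / 3 ≤ A.outputProb D f true) ∧
    (ENNReal.ofReal ε₂ ≤ distToClass D f H → 2 / 3 ≤ A.outputProb D f false)

/-- `q^tol_{ε₁,ε₂}(H)`: the least `q` such that there is an `(ε₁, ε₂)`-tolerant distribution-free
adaptive query tester for `H` with query complexity `q` (and `⊤` if there is none). -/
noncomputable def tolerantQueryComplexity {X : Type*} (𝓜 : MeasurableSpace X) (ε₁ ε₂ : ℝ)
    (H : Set (X → Bool)) : ℕ∞ :=
  ⨅ (q : ℕ) (_ : ∃ A : QueryAlgorithm 𝓜 q, A.IsTolerantTester ε₁ ε₂ H), (q : ℕ∞)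

/-! ### Halfspaces -/

/-- The class of halfspaces `x ↦ sign (w₀ + ∑ i, w i * x i)` over `ℝⁿ`, where `sign t` is `+1` if
`0 ≤ t` and `-1` otherwise. -/
def halfspaces (n : ℕ) : Set ((Fin n → ℝ) → Bool) :=
  {f | ∃ (w₀ : ℝ) (w : Fin n → ℝ), ∀ x, f x = true ↔ 0 ≤ w₀ + ∑ i, w i * x i}

/-! The bound reduces testing to telling small support from large support. The domain consists of a
dummy point of weight `4 * n` and `4 * n` points of weights `U i`, all placed on the moment curve,
where affine functions become polynomials of degree at most `n`. If at most `n` of the weights are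
nonzero, the support has at most `n + 1` points, and interpolation gives a halfspace agreeing there
with any labelling (`exists_halfspace_eq_on_momentCurve`). If all weights are at least `1` and their
sum is `O(n)`, the alternating labelling is at constant distance from every halfspace: a polynomial
of degree `n` has too few roots to follow `2 * n` sign changes (`card_le_of_halfspace_alternates`).
The label function is fixed in advance, so queries reveal nothing and only the samples carry
information about the distribution.

It remains to show that separating the two cases takes of order `n / log n` samples. The weights are
drawn independently from one of two laws on `[0, O(K²)]`, with `K` about `log n`, whose moments
agree up to order `K + 1` (`exists_moment_matching`). The first law is mostly at `0`; the second
lives on `[1, ∞)` and has bounded mean. By Markov's inequality the weights drawn from them typically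
fall in the respective cases. Quadratic growth of the nodes is what lets `K` moments match on a
range of only `K²` while a constant mass stays at `0`.

The acceptance probability, as a function of one weight `u`, is a power series whose weighted `ℓ¹`
norm on a radius of order `K²` is at most `exp (O(m K² / n))` (`hasMajorant_sampleMean_update`).
Truncating it after the matched moments costs this norm times `8 ^ (-(K + 2))`. Replacing the `4 *
n` weights one by one changes the acceptance probability by less than the required gap unless `m` is
at least of order `n / K`. The dummy weight keeps the normalizing denominator away from `0`, so
samples from the normalized law are handled directly, without Poissonization. -/

/-! ### Functions with a power series of bounded weighted `ℓ¹` norm -/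

/-- On `[0, r]` the function `f` is the sum of a power series `∑ a s * u ^ s` with
`∑ |a s| * r ^ s ≤ N`. -/
def HasMajorant (r N : ℝ) (f : ℝ → ℝ) : Prop :=
  ∃ a : ℕ → ℝ, Summable (fun s => |a s| * r ^ s) ∧ ∑' s, |a s| * r ^ s ≤ N ∧
    ∀ u, 0 ≤ u → u ≤ r → HasSum (fun s => a s * u ^ s) (f u)

namespace HasMajorant

variable {r N N' : ℝ} {f g : ℝ → ℝ}

theorem mono (h : HasMajorant r N f) (hN : N ≤ N') : HasMajorant r N' f := by
  obtain ⟨a, h1, h2, h3⟩ := h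
  exact ⟨a, h1, h2.trans hN, h3⟩

theorem nonneg (hr : 0 ≤ r) (h : HasMajorant r N f) : 0 ≤ N := by
  obtain ⟨a, -, h2, -⟩ := h
  exact (tsum_nonneg fun s => by positivity).trans h2

theorem const (c r : ℝ) : HasMajorant r |c| fun _ => c := by
  have key : ∀ (x y : ℝ), HasSum (fun s : ℕ => (if s = 0 then x else 0) * y ^ s) x := by
    intro x y
    simpa using hasSum_ite_eq (0 : ℕ) x |>.congr_fun (fun s => by
      by_cases hs : s = 0 <;> simp [hs])
  have h : (fun s : ℕ => |if s = 0 then c else 0| * r ^ s)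
      = fun s : ℕ => (if s = 0 then |c| else 0) * r ^ s := by
    funext s; by_cases hs : s = 0 <;> simp [hs]
  refine ⟨fun s => if s = 0 then c else 0, ?_, ?_, fun u _ _ => key c u⟩
  · rw [h]; exact (key _ _).summable
  · rw [h]; exact (key _ _).tsum_eq.le

theorem ident (r : ℝ) : HasMajorant r r fun u => u := by
  have key : ∀ y : ℝ, HasSum (fun s : ℕ => (if s = 1 then (1 : ℝ) else 0) * y ^ s) y := by
    intro y
    have := hasSum_ite_eq (1 : ℕ) y
    refine this.congr_fun (fun s => ?_)
    by_cases hs : s = 1 <;> simp [hs]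
  have h : (fun s : ℕ => |if s = 1 then (1 : ℝ) else 0| * r ^ s)
      = fun s : ℕ => (if s = 1 then (1 : ℝ) else 0) * r ^ s := by
    funext s; by_cases hs : s = 1 <;> simp [hs]
  refine ⟨fun s => if s = 1 then 1 else 0, ?_, ?_, fun u _ _ => key u⟩
  · rw [h]; exact (key _).summable
  · rw [h]; exact (key _).tsum_eq.le

/-- The geometric series in `-u / A` alternates; taking absolute values of its coefficients turns `A
+ r` into `A - r`. -/
theorem inv_add {A : ℝ} (hr : 0 ≤ r) (hA : r < A) :
    HasMajorant r (A - r)⁻¹ fun u => (A + u)⁻¹ := by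
  have hA0 : 0 < A := hr.trans_lt hA
  have hgeo : HasSum (fun s : ℕ => A⁻¹ * (r / A) ^ s) (A - r)⁻¹ := by
    have h := (hasSum_geometric_of_lt_one (div_nonneg hr hA0.le) ((div_lt_one hA0).2 hA)).mul_left
      A⁻¹
    have h2 : A⁻¹ * (1 - r / A)⁻¹ = (A - r)⁻¹ := by
      rw [← mul_inv]; congr 1; field_simp
    rwa [h2] at h
  have h : (fun s : ℕ => |A⁻¹ * (-A⁻¹) ^ s| * r ^ s) = fun s : ℕ => A⁻¹ * (r / A) ^ s := by
    funext s
    rw [abs_mul, abs_pow, abs_neg, abs_of_pos (inv_pos.2 hA0), mul_assoc, ← mul_pow]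
    congr 2; field_simp
  refine ⟨fun s => A⁻¹ * (-A⁻¹) ^ s, ?_, ?_, fun u hu hur => ?_⟩
  · rw [h]; exact hgeo.summable
  · rw [h]; exact hgeo.tsum_eq.le
  · have hu' : |(-(u / A))| < 1 := by
      rw [abs_neg, abs_of_nonneg (by positivity), div_lt_one hA0]; linarith
    have h := (hasSum_geometric_of_abs_lt_one hu').mul_left A⁻¹
    have h1 : (fun s : ℕ => A⁻¹ * (-(u / A)) ^ s) = fun s : ℕ => A⁻¹ * (-A⁻¹) ^ s * u ^ s := by
      funext s
      rw [mul_assoc, ← mul_pow]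
      congr 2; ring
    have h2 : A⁻¹ * (1 - -(u / A))⁻¹ = (A + u)⁻¹ := by
      rw [← mul_inv]; congr 1; field_simp; ring
    rwa [h1, h2] at h

theorem mul (hr : 0 ≤ r) (hf : HasMajorant r N f) (hg : HasMajorant r N' g) :
    HasMajorant r (N * N') fun u => f u * g u := by
  have hN := hf.nonneg hr
  obtain ⟨a, ha1, ha2, ha3⟩ := hf
  obtain ⟨b, hb1, hb2, hb3⟩ := hg
  have hna : ∀ u, 0 ≤ u → u ≤ r → Summable (fun s => ‖a s * u ^ s‖) := fun u hu hur =>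
    ha1.of_nonneg_of_le (fun s => norm_nonneg _) fun s => by
      rw [Real.norm_eq_abs, abs_mul, abs_of_nonneg (pow_nonneg hu s)]; gcongr
  have hnb : ∀ u, 0 ≤ u → u ≤ r → Summable (fun s => ‖b s * u ^ s‖) := fun u hu hur =>
    hb1.of_nonneg_of_le (fun s => norm_nonneg _) fun s => by
      rw [Real.norm_eq_abs, abs_mul, abs_of_nonneg (pow_nonneg hu s)]; gcongr
  have habs : ∀ (c d : ℕ → ℝ) (u : ℝ) (n : ℕ),
      ∑ kl ∈ Finset.HasAntidiagonal.antidiagonal n, c kl.1 * u ^ kl.1 * (d kl.2 * u ^ kl.2)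
        = (∑ kl ∈ Finset.HasAntidiagonal.antidiagonal n, c kl.1 * d kl.2) * u ^ n := by
    intro c d u n
    rw [Finset.sum_mul]
    refine Finset.sum_congr rfl fun kl hkl => ?_
    rw [← Finset.HasAntidiagonal.mem_antidiagonal.1 hkl, pow_add]; ring
  have hA : Summable fun s => ‖|a s| * r ^ s‖ := by
    simpa [abs_of_nonneg hr] using ha1
  have hB : Summable fun s => ‖|b s| * r ^ s‖ := by
    simpa [abs_of_nonneg hr] using hb1
  have hle : ∀ n, |∑ kl ∈ Finset.HasAntidiagonal.antidiagonal n, a kl.1 * b kl.2| * r ^ n ≤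
      ∑ kl ∈ Finset.HasAntidiagonal.antidiagonal n, |a kl.1| * r ^ kl.1 * (|b kl.2| * r ^ kl.2) := by
    intro n
    rw [habs (fun s => |a s|) (fun s => |b s|)]
    gcongr
    refine (Finset.abs_sum_le_sum_abs _ _).trans (le_of_eq ?_)
    simp [abs_mul]
  have hsum := (summable_norm_sum_mul_antidiagonal_of_summable_norm hA hB).of_norm
  have hs : Summable fun n => |∑ kl ∈ Finset.HasAntidiagonal.antidiagonal n, a kl.1 * b kl.2| * r ^ n :=
    hsum.of_nonneg_of_le (fun s => by positivity) hle
  refine ⟨fun n => ∑ kl ∈ Finset.HasAntidiagonal.antidiagonal n, a kl.1 * b kl.2, hs, ?_, fun u hu hur => ?_⟩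
  · calc _ ≤ ∑' n, ∑ kl ∈ Finset.HasAntidiagonal.antidiagonal n, |a kl.1| * r ^ kl.1 * (|b kl.2| * r ^ kl.2) :=
          hs.tsum_le_tsum hle hsum
      _ = (∑' s, |a s| * r ^ s) * ∑' s, |b s| * r ^ s :=
          (tsum_mul_tsum_eq_tsum_sum_antidiagonal_of_summable_norm hA hB).symm
      _ ≤ N * N' := mul_le_mul ha2 hb2 (tsum_nonneg fun s => by positivity) hN
  · have h1 := (summable_norm_sum_mul_antidiagonal_of_summable_norm
      (hna u hu hur) (hnb u hu hur)).of_norm.hasSum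
    rw [← tsum_mul_tsum_eq_tsum_sum_antidiagonal_of_summable_norm (hna u hu hur) (hnb u hu hur),
      (ha3 u hu hur).tsum_eq, (hb3 u hu hur).tsum_eq] at h1
    simpa only [habs] using h1

theorem add (hr : 0 ≤ r) (hf : HasMajorant r N f) (hg : HasMajorant r N' g) :
    HasMajorant r (N + N') fun u => f u + g u := by
  obtain ⟨a, ha1, ha2, ha3⟩ := hf
  obtain ⟨b, hb1, hb2, hb3⟩ := hg
  have hle : ∀ s, |a s + b s| * r ^ s ≤ |a s| * r ^ s + |b s| * r ^ s := fun s => by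
    rw [← add_mul]; gcongr; exact abs_add_le _ _
  have hs := (ha1.add hb1).of_nonneg_of_le (fun s => by positivity) hle
  refine ⟨fun s => a s + b s, hs, ?_, fun u hu hur => ?_⟩
  · refine (hs.tsum_le_tsum hle (ha1.add hb1)).trans ?_
    rw [ha1.tsum_add hb1]; gcongr
  · simpa only [add_mul] using (ha3 u hu hur).add (hb3 u hu hur)

theorem sum {ι : Type*} (hr : 0 ≤ r) (s : Finset ι) {B : ι → ℝ} {F : ι → ℝ → ℝ}
    (h : ∀ i ∈ s, HasMajorant r (B i) (F i)) :
    HasMajorant r (∑ i ∈ s, B i) fun u => ∑ i ∈ s, F i u := by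
  classical
  induction s using Finset.induction_on with
  | empty => simpa using const 0 r
  | insert i s hi ih =>
    simp only [Finset.sum_insert hi]
    exact (h i (by simp)).add hr (ih fun j hj => h j (by simp [hj]))

theorem prod {ι : Type*} (hr : 0 ≤ r) (s : Finset ι) {B : ι → ℝ} {F : ι → ℝ → ℝ}
    (h : ∀ i ∈ s, HasMajorant r (B i) (F i)) :
    HasMajorant r (∏ i ∈ s, B i) fun u => ∏ i ∈ s, F i u := by
  classical
  induction s using Finset.induction_on with
  | empty => simpa using const 1 r
  | insert i s hi ih =>
    simp only [Finset.prod_insert hi]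
    exact (h i (by simp)).mul hr (ih fun j hj => h j (by simp [hj]))

/-- Truncating the power series after `d` terms. -/
theorem exists_polynomial (hr : 0 ≤ r) (hf : HasMajorant r N f) {θ : ℝ} (hθ : 0 ≤ θ) (hθ1 : θ ≤ 1)
    (d : ℕ) :
    ∃ p : Polynomial ℝ, p.degree < d ∧ ∀ u, 0 ≤ u → u ≤ θ * r → |f u - p.eval u| ≤ N * θ ^ d := by
  obtain ⟨a, h1, h2, h3⟩ := hf
  refine ⟨∑ s ∈ Finset.range d, Polynomial.C (a s) * Polynomial.X ^ s, ?_, fun u hu hur => ?_⟩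
  · refine Polynomial.mem_degreeLT.1 (Submodule.sum_mem _ fun s hs => Polynomial.mem_degreeLT.2 ?_)
    refine (Polynomial.degree_C_mul_X_pow_le s (a s)).trans_lt ?_
    exact_mod_cast Finset.mem_range.1 hs
  · have hu' : u ≤ r := hur.trans (mul_le_of_le_one_left hr hθ1)
    have hsum := h3 u hu hu'
    have heq : f u - (∑ s ∈ Finset.range d, Polynomial.C (a s) * Polynomial.X ^ s).eval u
        = ∑' s, a (s + d) * u ^ (s + d) := by
      rw [← hsum.tsum_eq, ← hsum.summable.sum_add_tsum_nat_add d]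
      simp [Polynomial.eval_finsetSum]
    -- Shrinking the argument from `r` to `θ * r` gains a factor `θ` per degree, hence at least `θ ^
    -- d` on the tail.
    have hle : ∀ s, ‖a (s + d) * u ^ (s + d)‖ ≤ θ ^ d * (|a (s + d)| * r ^ (s + d)) := by
      intro s
      rw [Real.norm_eq_abs, abs_mul, abs_of_nonneg (pow_nonneg hu _)]
      calc |a (s + d)| * u ^ (s + d) ≤ |a (s + d)| * (r ^ s * (θ * r) ^ d) := by
            rw [pow_add]; gcongr
        _ = θ ^ d * (|a (s + d)| * r ^ (s + d)) := by rw [mul_pow, pow_add]; ring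
    have hs' : Summable fun s => |a (s + d)| * r ^ (s + d) := (summable_nat_add_iff d).2 h1
    rw [heq, ← Real.norm_eq_abs]
    refine (tsum_of_norm_bounded (hs'.mul_left _).hasSum hle).trans ?_
    rw [tsum_mul_left, mul_comm]
    gcongr
    refine le_trans ?_ h2
    rw [← h1.sum_add_tsum_nat_add d]
    exact le_add_of_nonneg_left (Finset.sum_nonneg fun s _ => by positivity)

end HasMajorant

/-! ### Two laws on `[0, O(K²)]` with the same first `K + 1` moments -/

-- With `K = i + 1 + j`, factoring each difference of squares gives the product the closed form `2
-- (K!)² / ((K - 1 - i)! (K + 1 + i)!)`. The induction on `j` adjoins the factors beyond `i` one at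
-- a time.
open Nat in
theorem prod_sq_div_sub_sq_mul_factorial (i j : ℕ) :
    (∏ l ∈ (Finset.range (i + 1 + j)).erase i,
      ((l + 1 : ℝ) ^ 2 / |(l + 1 : ℝ) ^ 2 - (i + 1 : ℝ) ^ 2|)) *
        ((j ! : ℝ) * ((2 * i + 2 + j)! : ℝ)) = 2 * ((i + 1 + j)! : ℝ) ^ 2 := by
  induction j with
  | zero =>
    have h1 : (Finset.range (i + 1 + 0)).erase i = Finset.range i := by
      rw [add_zero, Finset.range_add_one, Finset.erase_insert Finset.notMem_range_self]
    have h2 : ∀ l ∈ Finset.range i, ((l + 1 : ℝ) ^ 2 / |(l + 1 : ℝ) ^ 2 - (i + 1 : ℝ) ^ 2|)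
        = (((l + 1 : ℕ) : ℝ) ^ 2) / (((i - 1 - l + 1 : ℕ) : ℝ) * ((i + 1 + 1 + l : ℕ) : ℝ)) := by
      intro l hl
      have hl' := Finset.mem_range.1 hl
      have h3 : ((i - 1 - l + 1 : ℕ) : ℝ) = i - l := by
        rw [show i - 1 - l + 1 = i - l by omega, Nat.cast_sub hl'.le]
      have h4 : (l : ℝ) ≤ i := by exact_mod_cast hl'.le
      have h5 : (l + 1 : ℝ) ^ 2 - (i + 1 : ℝ) ^ 2 = -((i - l) * (i + 1 + 1 + l)) := by ring
      have h6 : (0 : ℝ) ≤ (i - l) * (i + 1 + 1 + l) := mul_nonneg (by linarith) (by positivity)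
      rw [h3, h5, abs_neg, abs_of_nonneg h6]
      push_cast
      rfl
    rw [h1, Finset.prod_congr rfl h2, Finset.prod_div_distrib, Finset.prod_mul_distrib,
      Finset.prod_pow, Finset.prod_range_reflect (fun l => ((l + 1 : ℕ) : ℝ)) i,
      ← Nat.cast_prod, ← Nat.cast_prod, Finset.prod_range_add_one_eq_factorial,
      ← Nat.ascFactorial_eq_prod_range]
    have h7 : ((i + 1)! : ℝ) * ((i + 1 + 1).ascFactorial i : ℝ) = ((2 * i + 1)! : ℝ) := by
      have := Nat.factorial_mul_ascFactorial (i + 1) i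
      rw [show i + 1 + i = 2 * i + 1 by ring] at this
      exact_mod_cast this
    have h8 : ((2 * i + 2 + 0)! : ℝ) = (2 * i + 2) * ((2 * i + 1)! : ℝ) := by
      rw [add_zero, Nat.factorial_succ (2 * i + 1)]; push_cast; ring
    have h9 : ((i + 1)! : ℝ) = (i + 1) * (i ! : ℝ) := by
      rw [Nat.factorial_succ]; push_cast; ring
    have h10 : ((i + 1 + 1).ascFactorial i : ℝ) ≠ 0 := by
      exact_mod_cast (Nat.ascFactorial_pos (i + 1) i).ne'
    have h11 : (i ! : ℝ) ≠ 0 := by exact_mod_cast Nat.factorial_ne_zero i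
    rw [h8, ← h7, add_zero, h9]
    field_simp
    simp
  | succ j ih =>
    have h1 : (Finset.range (i + 1 + (j + 1))).erase i
        = insert (i + 1 + j) ((Finset.range (i + 1 + j)).erase i) := by
      rw [← add_assoc, Finset.range_add_one, Finset.erase_insert_of_ne (by omega)]
    have h5 : ((i + 1 + j : ℕ) + 1 : ℝ) ^ 2 - (i + 1 : ℝ) ^ 2 = (j + 1) * (2 * i + 3 + j) := by
      push_cast; ring
    have h6 : (0 : ℝ) < (j + 1) * (2 * i + 3 + j) := by positivity
    rw [h1, Finset.prod_insert (by simp), h5, abs_of_pos h6]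
    have e1 : ((j + 1)! : ℝ) = (j + 1) * (j ! : ℝ) := by
      rw [Nat.factorial_succ]; push_cast; ring
    have e2 : ((2 * i + 2 + (j + 1))! : ℝ) = (2 * i + 3 + j) * ((2 * i + 2 + j)! : ℝ) := by
      rw [← add_assoc, Nat.factorial_succ]; push_cast; ring
    have e3 : ((i + 1 + (j + 1))! : ℝ) = (i + 1 + j + 1) * ((i + 1 + j)! : ℝ) := by
      rw [← add_assoc, Nat.factorial_succ]; push_cast; ring
    rw [e1, e2, e3, mul_pow, mul_left_comm 2, ← ih]
    push_cast
    field_simp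

-- The closed form is `2` times a binomial coefficient of `2 * K` divided by the central one, which
-- is the largest. Uniformity in `K` is what keeps the weights of the quadratic nodes under control.
open Nat in
theorem prod_sq_div_sub_sq_le {i K : ℕ} (hi : i < K) :
    ∏ l ∈ (Finset.range K).erase i, ((l + 1 : ℝ) ^ 2 / |(l + 1 : ℝ) ^ 2 - (i + 1 : ℝ) ^ 2|) ≤ 2 := by
  obtain ⟨j, rfl⟩ := Nat.exists_eq_add_of_lt hi
  rw [show i + j + 1 = i + 1 + j by ring]
  have h := prod_sq_div_sub_sq_mul_factorial i j
  have hle : ((i + 1 + j)!) ^ 2 ≤ j ! * (2 * i + 2 + j)! := by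
    have h1 := Nat.choose_le_centralBinom j (i + 1 + j)
    have h2 := Nat.choose_mul_factorial_mul_factorial (n := 2 * (i + 1 + j)) (k := j) (by omega)
    have h3 := Nat.choose_mul_factorial_mul_factorial (n := 2 * (i + 1 + j)) (k := i + 1 + j)
      (by omega)
    rw [show 2 * (i + 1 + j) - j = 2 * i + 2 + j by omega] at h2
    rw [show 2 * (i + 1 + j) - (i + 1 + j) = i + 1 + j by omega,
      ← Nat.centralBinom_eq_two_mul_choose] at h3
    have hpos := Nat.centralBinom_pos (i + 1 + j)
    refine Nat.le_of_mul_le_mul_left ?_ hpos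
    calc (i + 1 + j).centralBinom * (i + 1 + j)! ^ 2 = (2 * (i + 1 + j))! := by rw [← h3]; ring
      _ = (2 * (i + 1 + j)).choose j * (j ! * (2 * i + 2 + j)!) := by rw [← h2]; ring
      _ ≤ _ := by gcongr
  have hle' : ((i + 1 + j)! : ℝ) ^ 2 ≤ (j ! : ℝ) * ((2 * i + 2 + j)! : ℝ) := by exact_mod_cast hle
  have hpos : (0 : ℝ) < (j ! : ℝ) * ((2 * i + 2 + j)! : ℝ) := by positivity
  refine le_of_mul_le_mul_right ?_ hpos
  rw [h]
  gcongr

/-- The nodes `1, 100, 80000 · 1², 80000 · 2², …`. -/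
def momentNode : ℕ → ℝ
  | 0 => 1
  | 1 => 100
  | l + 2 => 80000 * (l + 1 : ℝ) ^ 2

/-- The coefficient of `p (momentNode i)` when `p 0` is expressed by the values of `p` at the first
`K + 2` nodes. -/
noncomputable def momentWeight (K i : ℕ) : ℝ :=
  ∏ j ∈ Finset.range (K + 2),
    if j = i then 1 else momentNode j / (momentNode j - momentNode i)

theorem le_momentNode_add_two (l : ℕ) : 80000 ≤ momentNode (l + 2) := by
  have : (1 : ℝ) ≤ (l + 1 : ℝ) ^ 2 := one_le_pow₀ (by simp)
  simp only [momentNode]; linarith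

theorem one_le_momentNode (i : ℕ) : 1 ≤ momentNode i := by
  match i with
  | 0 => simp [momentNode]
  | 1 => norm_num [momentNode]
  | l + 2 => linarith [le_momentNode_add_two l]

theorem momentNode_strictMono : StrictMono momentNode := by
  refine strictMono_nat_of_lt_succ fun i => ?_
  match i with
  | 0 => norm_num [momentNode]
  | 1 => norm_num [momentNode]
  | l + 2 => simp only [momentNode]; push_cast; nlinarith [(Nat.cast_nonneg l : (0 : ℝ) ≤ l)]

theorem momentNode_le {K i : ℕ} (hK : 1 ≤ K) (hi : i < K + 2) :
    momentNode i ≤ 80000 * (K : ℝ) ^ 2 := by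
  refine (momentNode_strictMono.monotone (show i ≤ (K - 1) + 2 by omega)).trans_eq ?_
  simp only [momentNode]
  rw [Nat.cast_sub hK]; simp

theorem eval_zero_eq_sum_momentWeight (K : ℕ) (p : Polynomial ℝ) (hp : p.degree < (K + 2 : ℕ)) :
    p.eval 0 = ∑ i ∈ Finset.range (K + 2), momentWeight K i * p.eval (momentNode i) := by
  have hinj : Set.InjOn momentNode (Finset.range (K + 2) : Set ℕ) :=
    momentNode_strictMono.injective.injOn
  have h := Lagrange.eq_interpolate (f := p) hinj (by simpa using hp)
  conv_lhs => rw [h]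
  rw [Lagrange.interpolate_apply, Polynomial.eval_finsetSum]
  refine Finset.sum_congr rfl fun i hi => ?_
  rw [Polynomial.eval_mul, Polynomial.eval_C, mul_comm, Lagrange.basis, Polynomial.eval_prod,
    momentWeight, ← Finset.mul_prod_erase _ _ hi, if_pos rfl, one_mul]
  congr 1
  refine Finset.prod_congr rfl fun j hj => ?_
  have hji := (Finset.mem_erase.1 hj).1
  have hne : momentNode j ≠ momentNode i := fun e => hji (momentNode_strictMono.injective e)
  rw [if_neg hji, Lagrange.basisDivisor]
  simp only [Polynomial.eval_mul, Polynomial.eval_C, Polynomial.eval_sub, Polynomial.eval_X]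
  have h1 : momentNode j - momentNode i ≠ 0 := sub_ne_zero.2 hne
  have h2 : momentNode i - momentNode j ≠ 0 := sub_ne_zero.2 hne.symm
  field_simp
  ring

theorem momentWeight_zero_nonneg (K : ℕ) : 0 ≤ momentWeight K 0 := by
  refine Finset.prod_nonneg fun j _ => ?_
  split_ifs with h
  · exact zero_le_one
  · have h1 := one_le_momentNode j
    have h2 : momentNode 0 = 1 := rfl
    exact div_nonneg (by linarith) (by linarith)

theorem momentWeight_one_nonpos (K : ℕ) : momentWeight K 1 ≤ 0 := by
  rw [momentWeight, Finset.prod_range_succ', Finset.prod_range_succ']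
  have h : 0 ≤ ∏ l ∈ Finset.range K, if l + 1 + 1 = 1 then (1 : ℝ) else
      momentNode (l + 1 + 1) / (momentNode (l + 1 + 1) - momentNode 1) := by
    refine Finset.prod_nonneg fun l _ => ?_
    have h1 := le_momentNode_add_two l
    have h2 : momentNode 1 = 100 := rfl
    rw [if_neg (by omega)]
    exact div_nonneg (by linarith) (by linarith)
  have h0 : momentNode 0 / (momentNode 0 - momentNode 1) ≤ 0 := by norm_num [momentNode]
  simp only [zero_add, if_true, zero_ne_one, if_false, mul_one]
  exact mul_nonpos_of_nonneg_of_nonpos h h0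

/-- The scale `80000` cancels in the factors from the quadratic nodes, whose product is at most `2`.
The nodes `1` and `100` contribute about `100 / y²` at `y = momentNode (l + 2)`. Multiplying by `y`
leaves `O(1 / y)`, which is summable over the quadratic nodes. -/
theorem abs_momentWeight_mul_le {K l : ℕ} (hl : l < K) :
    |momentWeight K (l + 2)| * momentNode (l + 2) ≤ 1 / 200 * (1 / (l + 1 : ℝ) ^ 2) := by
  have hy := le_momentNode_add_two l
  have hprod : |∏ j ∈ Finset.range K, if j + 1 + 1 = l + 2 then (1 : ℝ) else
      momentNode (j + 1 + 1) / (momentNode (j + 1 + 1) - momentNode (l + 2))| ≤ 2 := by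
    refine le_trans (le_of_eq ?_) (prod_sq_div_sub_sq_le hl)
    rw [Finset.abs_prod, ← Finset.mul_prod_erase _ _ (Finset.mem_range.2 hl)]
    simp only [if_true, abs_one, one_mul]
    refine Finset.prod_congr rfl fun j hj => ?_
    have hjl := (Finset.mem_erase.1 hj).1
    rw [if_neg (by omega), abs_div]
    simp only [momentNode]
    rw [← mul_sub, abs_mul, abs_mul, abs_of_nonneg (by positivity : (0 : ℝ) ≤ (j + 1 : ℝ) ^ 2),
      mul_div_mul_left _ _ (by norm_num)]
  rw [momentWeight, Finset.prod_range_succ', Finset.prod_range_succ', abs_mul, abs_mul]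
  have e : 1 / 200 * (1 / (l + 1 : ℝ) ^ 2) = 400 / momentNode (l + 2) := by
    simp only [momentNode]; field_simp; norm_num
  rw [e]
  set y := momentNode (l + 2) with hydef
  have h1 : (if 0 + 1 = l + 2 then (1 : ℝ) else momentNode (0 + 1) / (momentNode (0 + 1) - y))
      = 100 / (100 - y) := by rw [if_neg (by omega)]; rfl
  have h0 : (if 0 = l + 2 then (1 : ℝ) else momentNode 0 / (momentNode 0 - y))
      = 1 / (1 - y) := by rw [if_neg (by omega)]; rfl
  rw [h1, h0, abs_div, abs_div, abs_of_neg (by linarith : 100 - y < 0),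
    abs_of_neg (by linarith : 1 - y < 0), abs_one, abs_of_pos (by norm_num : (0 : ℝ) < 100)]
  have p1 : 0 < y - 100 := by linarith
  have p2 : 0 < y - 1 := by linarith
  have p3 : 0 < y := by linarith
  calc _ ≤ 2 * (100 / -(100 - y)) * (1 / -(1 - y)) * y := by
        rw [neg_sub, neg_sub]; gcongr
    _ ≤ 400 / y := by
        rw [neg_sub, neg_sub, le_div_iff₀ p3]
        have : 2 * (100 / (y - 100)) * (1 / (y - 1)) * y * y
          = 200 * (y * y) / ((y - 100) * (y - 1)) := by
          field_simp; norm_num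
        rw [this, div_le_iff₀ (by positivity)]
        nlinarith

/-- The correction `2 / (K + 1)` makes the bound telescope. -/
theorem sum_one_div_succ_sq_le (K : ℕ) :
    ∑ l ∈ Finset.range K, 1 / (l + 1 : ℝ) ^ 2 ≤ 2 - 2 / (K + 1 : ℝ) := by
  induction K with
  | zero => simp
  | succ K ih =>
    rw [Finset.sum_range_succ]
    have h : 1 / (K + 1 : ℝ) ^ 2 ≤ 2 / (K + 1) - 2 / ((K + 1 : ℕ) + 1) := by
      push_cast
      have e : 2 / (K + 1 : ℝ) - 2 / (K + 1 + 1) = 2 / ((K + 1) * (K + 2)) := by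
        field_simp; ring
      rw [e, div_le_div_iff₀ (by positivity) (by positivity)]
      nlinarith [(Nat.cast_nonneg K : (0 : ℝ) ≤ K)]
    linarith

theorem sum_abs_momentWeight_mul_le (K : ℕ) :
    ∑ l ∈ Finset.range K, |momentWeight K (l + 2)| * momentNode (l + 2) ≤ 1 / 100 := by
  calc _ ≤ ∑ l ∈ Finset.range K, 1 / 200 * (1 / (l + 1 : ℝ) ^ 2) :=
        Finset.sum_le_sum fun l hl => abs_momentWeight_mul_le (Finset.mem_range.1 hl)
    _ ≤ 1 / 200 * 2 := by
        rw [← Finset.mul_sum]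
        have : (0 : ℝ) ≤ 2 / (K + 1 : ℝ) := by positivity
        gcongr
        linarith [sum_one_div_succ_sq_le K]
    _ = 1 / 100 := by norm_num

/-- Two probability vectors on common nodes in `{0} ∪ [1, 80000 K²]` with equal moments up to order
`K + 1`; the first is mostly at `0`, the second does not charge `0` and has a bounded mean. -/
theorem exists_moment_matching {K : ℕ} (hK : 1 ≤ K) :
    ∃ x α β : Option (Fin (K + 2)) → ℝ,
      (∀ t, 0 ≤ α t) ∧ (∀ t, 0 ≤ β t) ∧ ∑ t, α t = 1 ∧ ∑ t, β t = 1 ∧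
      (∀ t, 0 ≤ x t ∧ x t ≤ 80000 * (K : ℝ) ^ 2) ∧ (∀ t, β t ≠ 0 → 1 ≤ x t) ∧
      ∑ t, α t * (if x t = 0 then 0 else 1) ≤ 1 / 40 ∧ ∑ t, β t * x t ≤ 2 ∧
      ∀ p : Polynomial ℝ, p.degree < (K + 2 : ℕ) →
        ∑ t, α t * p.eval (x t) = ∑ t, β t * p.eval (x t) := by
  set μ := momentWeight K with hμ
  set pos : ℕ → ℝ := fun i => max (μ i) 0 with hpos
  set neg : ℕ → ℝ := fun i => max (-μ i) 0 with hneg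
  set Z := ∑ i ∈ Finset.range (K + 2), pos i with hZ
  have hpos0 : ∀ i, 0 ≤ pos i := fun i => le_max_right _ _
  have hneg0 : ∀ i, 0 ≤ neg i := fun i => le_max_right _ _
  have hposneg : ∀ i, pos i - neg i = μ i := fun i => by
    simp only [hpos, hneg]
    rcases le_total 0 (μ i) with h | h
    · rw [max_eq_left h, max_eq_right (by linarith)]; ring
    · rw [max_eq_right h, max_eq_left (by linarith)]; ring
  have hmom : ∀ p : Polynomial ℝ, p.degree < (K + 2 : ℕ) →
      p.eval 0 + ∑ i ∈ Finset.range (K + 2), neg i * p.eval (momentNode i)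
        = ∑ i ∈ Finset.range (K + 2), pos i * p.eval (momentNode i) := fun p hp => by
    rw [eval_zero_eq_sum_momentWeight K p hp, ← Finset.sum_add_distrib]
    refine Finset.sum_congr rfl fun i _ => ?_
    rw [← hμ, ← hposneg]; ring
  have hone : 1 + ∑ i ∈ Finset.range (K + 2), neg i = Z := by
    have h := hmom 1 (by rw [Polynomial.degree_one]; exact_mod_cast Nat.succ_pos _)
    simpa using h
  have hid : ∑ i ∈ Finset.range (K + 2), neg i * momentNode i
      = ∑ i ∈ Finset.range (K + 2), pos i * momentNode i := by
    have h := hmom Polynomial.X (by rw [Polynomial.degree_X]; exact_mod_cast (by omega : 1 < K + 2))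
    simpa using h
  have hZ1 : 1 ≤ Z := by
    rw [← hone]; linarith [Finset.sum_nonneg fun i (_ : i ∈ Finset.range (K + 2)) => hneg0 i]
  have hZ0 : 0 < Z := by linarith
  have hsplit : ∀ g : ℕ → ℝ, ∑ i ∈ Finset.range (K + 2), g i
      = ∑ l ∈ Finset.range K, g (l + 2) + g 1 + g 0 := fun g => by
    rw [Finset.sum_range_succ', Finset.sum_range_succ']
  have hn0 : neg 0 = 0 := max_eq_right (by linarith [momentWeight_zero_nonneg K])
  have hp1 : pos 1 = 0 := max_eq_right (momentWeight_one_nonpos K)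
  have hbig := sum_abs_momentWeight_mul_le K
  have hposle : ∀ i, pos i ≤ |μ i| := fun i => max_le (le_abs_self _) (abs_nonneg _)
  have hnegle : ∀ i, neg i ≤ |μ i| := fun i => max_le (neg_le_abs _) (abs_nonneg _)
  have hN1 : ∀ i, 1 ≤ momentNode i := one_le_momentNode
  have b1 : ∑ l ∈ Finset.range K, pos (l + 2) * momentNode (l + 2) ≤ 1 / 100 :=
    (Finset.sum_le_sum fun l _ => mul_le_mul_of_nonneg_right (hposle _)
      (by linarith [hN1 (l + 2)])).trans hbig
  have b2 : ∑ l ∈ Finset.range K, neg (l + 2) ≤ 1 / 100 :=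
    (Finset.sum_le_sum fun l _ => (hnegle _).trans
      (le_mul_of_one_le_right (abs_nonneg _) (hN1 _))).trans hbig
  have b3 : 0 ≤ ∑ l ∈ Finset.range K, pos (l + 2) := Finset.sum_nonneg fun _ _ => hpos0 _
  have b4 : 0 ≤ ∑ l ∈ Finset.range K, neg (l + 2) * momentNode (l + 2) :=
    Finset.sum_nonneg fun l _ => mul_nonneg (hneg0 _) (by linarith [hN1 (l + 2)])
  have e0 : momentNode 0 = 1 := rfl
  have e1 : momentNode 1 = 100 := rfl
  have hZ' := hsplit pos
  have hone' := hsplit neg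
  have hid1 := hsplit fun i => neg i * momentNode i
  have hid2 := hsplit fun i => pos i * momentNode i
  simp only [hn0, hp1, e0, e1] at hZ' hone' hid1 hid2
  rw [hid1, hid2] at hid
  rw [hone'] at hone
  rw [← hZ] at hZ'
  -- Moving the negative weights to the side of `p 0` makes both sides of the extrapolation formula
  -- positive combinations of total mass `Z`. Here `none` is the node `0`, which only `α` charges.
  refine ⟨fun t => t.elim 0 fun i => momentNode i, fun t => t.elim (1 / Z) fun i => neg i / Z,
    fun t => t.elim 0 fun i => pos i / Z, ?_, ?_, ?_, ?_, ?_, ?_, ?_, ?_, ?_⟩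
  · rintro (_ | i)
    · exact div_nonneg zero_le_one hZ0.le
    · exact div_nonneg (hneg0 _) hZ0.le
  · rintro (_ | i)
    · exact le_rfl
    · exact div_nonneg (hpos0 _) hZ0.le
  · rw [Fintype.sum_option]
    simp only [Option.elim]
    rw [Fin.sum_univ_eq_sum_range (fun i => neg i / Z), ← Finset.sum_div, ← add_div, hone',
      hone, div_self hZ0.ne']
  · rw [Fintype.sum_option]
    simp only [Option.elim]
    rw [Fin.sum_univ_eq_sum_range (fun i => pos i / Z), ← Finset.sum_div, ← hZ, zero_add,
      div_self hZ0.ne']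
  · rintro (_ | i)
    · exact ⟨le_rfl, by simp only [Option.elim]; positivity⟩
    · exact ⟨by simp only [Option.elim]; linarith [hN1 i], momentNode_le hK i.2⟩
  · rintro (_ | i) h
    · exact absurd rfl h
    · exact hN1 i
  · rw [Fintype.sum_option]
    have hne : ∀ i : ℕ, momentNode i ≠ 0 := fun i => by linarith [hN1 i]
    simp only [Option.elim, if_true, mul_zero, zero_add, hne, if_false, mul_one]
    rw [Fin.sum_univ_eq_sum_range (fun i => neg i / Z), ← Finset.sum_div, hone', div_le_iff₀ hZ0]
    -- No formula for the first two weights is needed: the identity for `p = X` gives `100 * neg 1 ≤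
    -- pos 0 + 1 / 100` with `pos 0 ≤ Z`, and `b2` bounds the remaining negative mass.
    linarith
  · rw [Fintype.sum_option]
    simp only [Option.elim, mul_zero, zero_add]
    rw [Fin.sum_univ_eq_sum_range (fun i => pos i / Z * momentNode i)]
    simp only [div_mul_eq_mul_div]
    rw [← Finset.sum_div, hid2, div_le_iff₀ hZ0]
    linarith
  · intro p hp
    rw [Fintype.sum_option, Fintype.sum_option]
    simp only [Option.elim]
    rw [Fin.sum_univ_eq_sum_range (fun i => neg i / Z * p.eval (momentNode i)),
      Fin.sum_univ_eq_sum_range (fun i => pos i / Z * p.eval (momentNode i))]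
    simp only [div_mul_eq_mul_div]
    rw [← Finset.sum_div, ← Finset.sum_div, ← hmom p hp]
    ring

/-! ### Expectations under product laws on a finite set -/

theorem Fintype.sum_fin_succ_arrow {T M : Type*} [Fintype T] [AddCommMonoid M] {k : ℕ}
    (F : (Fin (k + 1) → T) → M) :
    ∑ t, F t = ∑ s, ∑ t' : Fin k → T, F (Fin.cons s t') := by
  rw [← Fintype.sum_prod_type']
  exact (Fintype.sum_equiv (Fin.consEquiv fun _ => T) _ _ fun _ => rfl).symm

section

variable {T : Type*} [Fintype T] {α β : T → ℝ}

theorem sum_prod_eq_one (hα : ∑ t, α t = 1) (k : ℕ) : ∑ t : Fin k → T, ∏ i, α (t i) = 1 := by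
  classical
  have h := Finset.prod_univ_sum (fun _ : Fin k => (Finset.univ : Finset T)) fun _ t => α t
  rw [Fintype.piFinset_univ] at h
  rw [← h, hα, Finset.prod_const_one]

theorem sum_prod_mul_apply (hα : ∑ t, α t = 1) {k : ℕ} (g : T → ℝ) (j : Fin k) :
    ∑ t : Fin k → T, (∏ i, α (t i)) * g (t j) = ∑ t, α t * g t := by
  classical
  have h := Finset.prod_univ_sum (fun _ : Fin k => (Finset.univ : Finset T))
    fun i t => α t * if i = j then g t else 1
  rw [Fintype.piFinset_univ] at h
  simp only [Finset.prod_mul_distrib] at h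
  have e : ∀ t : Fin k → T, (∏ i, if i = j then g (t i) else 1) = g (t j) := fun t => by
    simp
  simp only [e] at h
  rw [← h, Finset.prod_eq_single j]
  · simp
  · intro i _ hi; simp [hi, hα]
  · simp

theorem sum_prod_mul_sum (hα : ∑ t, α t = 1) (k : ℕ) (g : T → ℝ) :
    ∑ t : Fin k → T, (∏ i, α (t i)) * ∑ j, g (t j) = k * ∑ t, α t * g t := by
  simp only [Finset.mul_sum]
  rw [Finset.sum_comm]
  simp only [sum_prod_mul_apply hα, ← Finset.mul_sum]
  simp

/-- Replacing the coordinates of a product law one at a time. -/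
theorem abs_sum_prod_sub_sum_prod_le [DecidableEq T] (hα0 : ∀ t, 0 ≤ α t) (hβ0 : ∀ t, 0 ≤ β t)
    (hα : ∑ t, α t = 1) (hβ : ∑ t, β t = 1) {δ : ℝ} {k : ℕ} (F : (Fin k → T) → ℝ)
    (h : ∀ t j, |∑ s, α s * F (Function.update t j s) - ∑ s, β s * F (Function.update t j s)| ≤ δ) :
    |∑ t : Fin k → T, (∏ i, α (t i)) * F t - ∑ t : Fin k → T, (∏ i, β (t i)) * F t| ≤ k * δ := by
  induction k with
  | zero => simp
  | succ k ih =>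
    rw [Fintype.sum_fin_succ_arrow, Fintype.sum_fin_succ_arrow]
    simp only [Fin.prod_univ_succ, Fin.cons_zero, Fin.cons_succ, mul_assoc, ← Finset.mul_sum]
    have h1 : |∑ s, α s * ∑ t' : Fin k → T, (∏ i, α (t' i)) * F (Fin.cons s t')
        - ∑ s, α s * ∑ t' : Fin k → T, (∏ i, β (t' i)) * F (Fin.cons s t')| ≤ k * δ := by
      rw [← Finset.sum_sub_distrib]
      calc _ ≤ ∑ s, α s * (k * δ) := by
            refine (Finset.abs_sum_le_sum_abs _ _).trans (Finset.sum_le_sum fun s _ => ?_)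
            rw [← mul_sub, abs_mul, abs_of_nonneg (hα0 s)]
            refine mul_le_mul_of_nonneg_left (ih _ fun t j => ?_) (hα0 s)
            simpa only [Fin.cons_update] using h (Fin.cons s t) j.succ
        _ = k * δ := by rw [← Finset.sum_mul, hα, one_mul]
    have h2 : |∑ s, α s * ∑ t' : Fin k → T, (∏ i, β (t' i)) * F (Fin.cons s t')
        - ∑ s, β s * ∑ t' : Fin k → T, (∏ i, β (t' i)) * F (Fin.cons s t')| ≤ δ := by
      have e : ∀ γ : T → ℝ, ∑ s, γ s * ∑ t' : Fin k → T, (∏ i, β (t' i)) * F (Fin.cons s t')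
          = ∑ t' : Fin k → T, (∏ i, β (t' i)) * ∑ s, γ s * F (Fin.cons s t') := fun γ => by
        simp only [Finset.mul_sum]
        rw [Finset.sum_comm]
        simp only [mul_left_comm]
      have hT : Nonempty T := by
        by_contra hT
        rw [not_nonempty_iff] at hT
        simp at hα
      obtain ⟨s₀⟩ := hT
      rw [e, e, ← Finset.sum_sub_distrib]
      calc _ ≤ ∑ t' : Fin k → T, (∏ i, β (t' i)) * δ := by
            refine (Finset.abs_sum_le_sum_abs _ _).trans (Finset.sum_le_sum fun t' _ => ?_)
            have hnn : 0 ≤ ∏ i, β (t' i) := Finset.prod_nonneg fun i _ => hβ0 _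
            rw [← mul_sub, abs_mul, abs_of_nonneg hnn]
            refine mul_le_mul_of_nonneg_left ?_ hnn
            simpa only [Fin.update_cons_zero] using h (Fin.cons s₀ t') 0
        _ = δ := by rw [← Finset.sum_mul, sum_prod_eq_one hβ, one_mul]
    have h3 := abs_sub_le _ _ _ |>.trans (add_le_add h1 h2)
    push_cast
    linarith

end

/-! ### Sampling from a weight vector with a dummy point -/

/-- The probability of `c` under the law on `Option ι` with weight `M` at `none` and `U i` at
`some i`, after normalization. -/
noncomputable def sampleMass {ι : Type*} [Fintype ι] (M : ℝ) (U : ι → ℝ) (c : Option ι) : ℝ :=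
  c.elim M U / (M + ∑ i, U i)

/-- The mean of `a` at `m` independent samples with law `sampleMass M U`. -/
noncomputable def sampleMean {ι : Type*} [Fintype ι] {m : ℕ} (a : (Fin m → Option ι) → ℝ) (M : ℝ)
    (U : ι → ℝ) : ℝ :=
  ∑ σ : Fin m → Option ι, (∏ i, sampleMass M U (σ i)) * a σ

section

variable {ι : Type*} [Fintype ι] {M : ℝ} {U : ι → ℝ}

theorem sampleMass_nonneg (hM : 0 < M) (hU : ∀ i, 0 ≤ U i) (c : Option ι) :
    0 ≤ sampleMass M U c := by
  refine div_nonneg ?_ (add_nonneg hM.le (Finset.sum_nonneg fun i _ => hU i))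
  cases c with
  | none => exact hM.le
  | some i => exact hU i

theorem sum_sampleMass (hM : 0 < M) (hU : ∀ i, 0 ≤ U i) : ∑ c, sampleMass M U c = 1 := by
  have : 0 < M + ∑ i, U i := add_pos_of_pos_of_nonneg hM (Finset.sum_nonneg fun i _ => hU i)
  simp only [sampleMass]
  rw [← Finset.sum_div, Fintype.sum_option]
  exact div_self this.ne'

theorem sampleMean_nonneg {m : ℕ} {a : (Fin m → Option ι) → ℝ} (ha : ∀ σ, 0 ≤ a σ) (hM : 0 < M)
    (hU : ∀ i, 0 ≤ U i) : 0 ≤ sampleMean a M U :=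
  Finset.sum_nonneg fun σ _ => mul_nonneg
    (Finset.prod_nonneg fun i _ => sampleMass_nonneg hM hU (σ i)) (ha σ)

theorem sampleMean_le_one {m : ℕ} {a : (Fin m → Option ι) → ℝ} (ha : ∀ σ, a σ ≤ 1) (hM : 0 < M)
    (hU : ∀ i, 0 ≤ U i) : sampleMean a M U ≤ 1 := by
  rw [← sum_prod_eq_one (sum_sampleMass hM hU) m]
  exact Finset.sum_le_sum fun σ _ => mul_le_of_le_one_right
    (Finset.prod_nonneg fun i _ => sampleMass_nonneg hM hU (σ i)) (ha σ)

/-- Each mass is a constant or `u` times `(A + u)⁻¹`. Its norm is at most `B c / (A - r)`, where `B`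
lists the numerators at `u = r`. Since the bounds are multiplicative, summing over all sample
sequences gives the `m`-th power of `(A + r) / (A - r)`, which is at most `1 + 4 * r / M` because `A
- r ≥ M / 2`. -/
theorem hasMajorant_sampleMean_update [DecidableEq ι] {m : ℕ} {a : (Fin m → Option ι) → ℝ}
    (ha : ∀ σ, |a σ| ≤ 1) {r : ℝ} (hr : 0 ≤ r) (hrM : 2 * r ≤ M) (hM : 0 < M) (hU : ∀ i, 0 ≤ U i)
    (j : ι) :
    HasMajorant r ((1 + 4 * r / M) ^ m) fun u => sampleMean a M (Function.update U j u) := by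
  set A := M + ∑ i ∈ Finset.univ.erase j, U i with hA
  have hAM : M ≤ A := le_add_of_nonneg_right (Finset.sum_nonneg fun i _ => hU i)
  have hsum : ∀ u, M + ∑ i, Function.update U j u i = A + u := fun u => by
    rw [← Finset.add_sum_erase _ _ (Finset.mem_univ j), Function.update_self, hA,
      Finset.sum_congr rfl fun i hi => Function.update_of_ne (Finset.ne_of_mem_erase hi) u U]
    ring
  set B : Option ι → ℝ := fun c => c.elim M (Function.update U j r) with hB
  have hmass : ∀ c, HasMajorant r (B c * (A - r)⁻¹)
      fun u => sampleMass M (Function.update U j u) c := by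
    intro c
    have hnum : HasMajorant r (B c) fun u => c.elim M (Function.update U j u) := by
      cases c with
      | none => simpa [hB, abs_of_pos hM] using HasMajorant.const M r
      | some i =>
        by_cases hij : i = j
        · subst hij; simpa [hB] using HasMajorant.ident r
        · simpa [hB, hij, abs_of_nonneg (hU i)] using HasMajorant.const (U i) r
    simpa only [sampleMass, hsum, div_eq_mul_inv] using
      hnum.mul hr (HasMajorant.inv_add hr (by linarith : r < A))
  have hBsum : ∑ c, B c * (A - r)⁻¹ ≤ 1 + 4 * r / M := by
    rw [← Finset.sum_mul, Fintype.sum_option]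
    simp only [hB, Option.elim]
    rw [hsum, ← div_eq_mul_inv, div_le_iff₀ (by linarith)]
    have : (1 + 4 * r / M) * (A - r) = A - r + 4 * r * ((A - r) / M) := by field_simp
    rw [this]
    have h2 : 1 / 2 ≤ (A - r) / M := by rw [le_div_iff₀ hM]; linarith
    nlinarith
  have hB0 : ∀ c, 0 ≤ B c * (A - r)⁻¹ := fun c => (hmass c).nonneg hr
  have h := HasMajorant.sum hr Finset.univ (F := fun (σ : Fin m → Option ι) u =>
      (∏ i, sampleMass M (Function.update U j u) (σ i)) * a σ)
    (B := fun σ => (∏ i, B (σ i) * (A - r)⁻¹) * |a σ|) fun σ _ =>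
      (HasMajorant.prod hr Finset.univ fun i _ => hmass (σ i)).mul hr (HasMajorant.const (a σ) r)
  refine h.mono ?_
  calc _ ≤ ∑ σ : Fin m → Option ι, ∏ i, B (σ i) * (A - r)⁻¹ :=
        Finset.sum_le_sum fun σ _ => mul_le_of_le_one_right
          (Finset.prod_nonneg fun i _ => hB0 _) (ha σ)
    _ = (∑ c, B c * (A - r)⁻¹) ^ m := by
        classical
        have h := Finset.prod_univ_sum (fun _ : Fin m => (Finset.univ : Finset (Option ι)))
          fun _ c => B c * (A - r)⁻¹
        rw [Fintype.piFinset_univ] at h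
        rw [← h, Finset.prod_const, Finset.card_univ, Fintype.card_fin]
    _ ≤ _ := pow_le_pow_left₀ (Finset.sum_nonneg fun c _ => hB0 c) hBsum m

/-- Two laws with the same moments up to order `d - 1` are hard to tell apart from samples. -/
theorem abs_sum_sampleMean_sub_le {T : Type*} [Fintype T] {x α β : T → ℝ} {k d m : ℕ} {lam : ℝ}
    {a : (Fin m → Option (Fin k)) → ℝ} (ha : ∀ σ, |a σ| ≤ 1) (hM : 0 < M)
    (hα0 : ∀ t, 0 ≤ α t) (hβ0 : ∀ t, 0 ≤ β t) (hα : ∑ t, α t = 1) (hβ : ∑ t, β t = 1)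
    (hx : ∀ t, 0 ≤ x t ∧ x t ≤ lam) (hlam : 0 ≤ lam) (hlamM : 16 * lam ≤ M)
    (hmom : ∀ p : Polynomial ℝ, p.degree < d →
        ∑ t, α t * p.eval (x t) = ∑ t, β t * p.eval (x t)) :
    |∑ t : Fin k → T, (∏ i, α (t i)) * sampleMean a M (x ∘ t)
      - ∑ t : Fin k → T, (∏ i, β (t i)) * sampleMean a M (x ∘ t)|
      ≤ k * (2 * ((1 + 32 * lam / M) ^ m * (1 / 8) ^ d)) := by
  classical
  refine abs_sum_prod_sub_sum_prod_le hα0 hβ0 hα hβ _ fun t j => ?_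
  -- The series is controlled on eight times the range of the weights, so `θ = 1 / 8` below covers
  -- that range exactly.
  have h := hasMajorant_sampleMean_update ha (r := 8 * lam) (by positivity) (by linarith) hM
    (fun i => (hx (t i)).1) j
  obtain ⟨p, hp, hpe⟩ := h.exists_polynomial (by positivity) (θ := 1 / 8) (by norm_num)
    (by norm_num) d
  set E := (1 + 4 * (8 * lam) / M) ^ m * (1 / 8) ^ d with hE
  have hE' : (1 + 32 * lam / M) ^ m * (1 / 8) ^ d = E := by rw [hE]; ring_nf
  have hcomp : ∀ s, x ∘ Function.update t j s = Function.update (fun i => x (t i)) j (x s) :=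
    fun s => Function.comp_update x t j s
  have key : ∀ γ : T → ℝ, (∀ s, 0 ≤ γ s) → ∑ s, γ s = 1 →
      |∑ s, γ s * sampleMean a M (x ∘ Function.update t j s) - ∑ s, γ s * p.eval (x s)| ≤ E := by
    intro γ h0 h1
    rw [← Finset.sum_sub_distrib]
    calc _ ≤ ∑ s, γ s * E := by
          refine (Finset.abs_sum_le_sum_abs _ _).trans (Finset.sum_le_sum fun s _ => ?_)
          rw [← mul_sub, abs_mul, abs_of_nonneg (h0 s), hcomp]
          exact mul_le_mul_of_nonneg_left (hpe (x s) (hx s).1 (by linarith [(hx s).2])) (h0 s)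
      _ = E := by rw [← Finset.sum_mul, h1, one_mul]
  have k1 := key α hα0 hα
  have k2 := key β hβ0 hβ
  rw [hmom p hp] at k1
  rw [hE']
  have k3 := abs_sub_le (∑ s, α s * sampleMean a M (x ∘ Function.update t j s))
    (∑ s, β s * p.eval (x s)) (∑ s, β s * sampleMean a M (x ∘ Function.update t j s))
  rw [abs_sub_comm (∑ s, β s * p.eval (x s))] at k3
  linarith

end

/-! ### Deciding whether the support is small needs `Ω(n / log n)` samples -/

theorem exists_forall_log_sq_le (C : ℝ) : ∃ N : ℕ, ∀ n : ℕ, N ≤ n → C * Real.log n ^ 2 ≤ n := by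
  have h := (Real.isLittleO_pow_log_id_atTop (n := 2)).comp_tendsto tendsto_natCast_atTop_atTop
  have hC : 0 < 1 / (|C| + 1) := by positivity
  obtain ⟨N, hN⟩ := Filter.eventually_atTop.1 (h.bound hC)
  refine ⟨N, fun n hn => ?_⟩
  have h1 := hN n hn
  simp only [Function.comp, id, Real.norm_eq_abs, abs_pow, sq_abs, Nat.abs_cast] at h1
  rw [one_div_mul_eq_div, le_div_iff₀ (by positivity)] at h1
  nlinarith [le_abs_self C, sq_nonneg (Real.log n)]

theorem natLog_two_le_two_mul_log {n : ℕ} (hn : n ≠ 0) : (Nat.log 2 n : ℝ) ≤ 2 * Real.log n := by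
  have h1 : Real.log ((2 : ℝ) ^ Nat.log 2 n) ≤ Real.log n :=
    Real.log_le_log (by positivity) (by exact_mod_cast Nat.pow_log_le_self 2 hn)
  rw [Real.log_pow] at h1
  have h2 := Real.log_two_gt_d9
  have h3 : (0 : ℝ) ≤ Nat.log 2 n := Nat.cast_nonneg _
  nlinarith

/-- The samples of a two-law mixture do not separate small from full support if there are few. -/
theorem lt_of_separates {n m : ℕ} (hn : 2 ≤ n) {a : (Fin m → Option (Fin (4 * n))) → ℝ}
    (ha0 : ∀ σ, 0 ≤ a σ) (ha1 : ∀ σ, a σ ≤ 1)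
    (hsmall : ∀ U : Fin (4 * n) → ℝ, (∀ i, 0 ≤ U i) → {i | U i ≠ 0}.ncard ≤ n →
      2 / 3 ≤ sampleMean a (4 * n) U)
    (hlarge : ∀ U : Fin (4 * n) → ℝ, (∀ i, 1 ≤ U i) → ∑ i, U i ≤ 400 * n →
      sampleMean a (4 * n) U ≤ 1 / 3)
    (hK : 320000 * (Nat.log 2 n : ℝ) ^ 2 ≤ n) :
    (n : ℝ) < m * (1280000 * Nat.log 2 n) := by
  set K := Nat.log 2 n with hKdef
  have hK1 : 1 ≤ K := Nat.log_pos one_lt_two hn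
  have hn0 : (0 : ℝ) < n := by exact_mod_cast (by omega : 0 < n)
  have hM : (0 : ℝ) < 4 * n := by positivity
  obtain ⟨x, α, β, hα0, hβ0, hα, hβ, hx, hβx, hαs, hβm, hmom⟩ := exists_moment_matching hK1
  by_contra! hcon
  have hdiff := abs_sum_sampleMean_sub_le (a := a) (m := m) (k := 4 * n) (d := K + 2)
    (lam := 80000 * (K : ℝ) ^ 2) (M := 4 * n)
    (fun σ => abs_le.2 ⟨by linarith [ha0 σ], ha1 σ⟩) hM hα0 hβ0 hα hβ hx (by positivity)
    (by linarith) hmom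
  -- Under `hcon` the exponent is at most `K / 2`, and `exp (1 / 2) ≤ 2`.
  have hgrow : (1 + 32 * (80000 * (K : ℝ) ^ 2) / (4 * n)) ^ m ≤ 2 ^ K := by
    have hexp : Real.exp (1 / 2) ≤ 2 := by
      have h1 : Real.exp (1 / 2) ^ 2 = Real.exp 1 := by rw [← Real.exp_nat_mul]; norm_num
      have h2 := Real.exp_one_lt_d9
      nlinarith [Real.exp_pos (1 / 2)]
    calc _ ≤ Real.exp (32 * (80000 * (K : ℝ) ^ 2) / (4 * n)) ^ m := by
          refine pow_le_pow_left₀ (by positivity) ?_ m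
          rw [add_comm]; exact Real.add_one_le_exp _
      _ = Real.exp (m * (1280000 * K) * (K / (2 * n))) := by
          rw [← Real.exp_nat_mul]; congr 1; field_simp; ring
      _ ≤ Real.exp (n * (K / (2 * n))) := by gcongr
      _ = Real.exp (1 / 2) ^ K := by rw [← Real.exp_nat_mul]; congr 1; field_simp
      _ ≤ 2 ^ K := pow_le_pow_left₀ (Real.exp_pos _).le hexp K
  -- Three factors of size about `2 ^ K` compete with `8 ^ (-K)`: one is `hgrow`, one comes from `n
  -- < 2 ^ (K + 1)`, and one absorbs a constant `2`. The two extra matched moments supply the final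
  -- slack.
  have hsmallerr : ((4 * n : ℕ) : ℝ) * (2 * ((1 + 32 * (80000 * (K : ℝ) ^ 2) / (4 * n)) ^ m
      * (1 / 8) ^ (K + 2))) ≤ 1 / 8 := by
    have hn2 : (n : ℝ) ≤ 2 * 2 ^ K := by
      have := (Nat.lt_pow_succ_log_self one_lt_two n).le
      rw [pow_succ] at this
      have h : (n : ℝ) ≤ 2 ^ K * 2 := by exact_mod_cast this
      linarith
    have h2K : (2 : ℝ) ≤ 2 ^ K := le_self_pow₀ one_le_two (by omega)
    have h8 : (1 / 8 : ℝ) ^ K * (2 ^ K * 2 ^ K * 2 ^ K) = 1 := by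
      rw [← mul_pow, ← mul_pow, ← mul_pow]; norm_num
    have hp8 : (0 : ℝ) < (1 / 8) ^ K := by positivity
    calc _ ≤ ((4 * n : ℕ) : ℝ) * (2 * (2 ^ K * (1 / 8) ^ (K + 2))) := by gcongr
      _ = n * 2 ^ K * (1 / 8) ^ K / 8 := by push_cast; ring
      _ ≤ (2 * 2 ^ K) * 2 ^ K * (1 / 8) ^ K / 8 := by gcongr
      _ ≤ (2 ^ K * 2 ^ K) * 2 ^ K * (1 / 8) ^ K / 8 := by gcongr
      _ = 1 / 8 := by rw [mul_comm _ ((1 / 8 : ℝ) ^ K), h8]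
  have hwα : ∀ t : Fin (4 * n) → Option (Fin (K + 2)), 0 ≤ ∏ i, α (t i) :=
    fun t => Finset.prod_nonneg fun i _ => hα0 _
  have hwβ : ∀ t : Fin (4 * n) → Option (Fin (K + 2)), 0 ≤ ∏ i, β (t i) :=
    fun t => Finset.prod_nonneg fun i _ => hβ0 _
  have hAα : 2 / 3 - 1 / 10 ≤
      ∑ t : Fin (4 * n) → Option (Fin (K + 2)), (∏ i, α (t i)) * sampleMean a (4 * n) (x ∘ t) := by
    -- Markov's inequality in pointwise form: when the support exceeds `n`, the left side is
    -- negative. The expected support size is at most `4 * n / 40`, whence the loss `1 / 10`.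
    have hle : ∀ t : Fin (4 * n) → Option (Fin (K + 2)),
        2 / 3 - (∑ i, if x (t i) = 0 then (0 : ℝ) else 1) / n ≤ sampleMean a (4 * n) (x ∘ t) := by
      intro t
      have hcard : (∑ i, if x (t i) = 0 then (0 : ℝ) else 1)
          = ({i | (x ∘ t) i ≠ 0}.ncard : ℝ) := by
        rw [Set.ncard_eq_toFinset_card', Set.toFinset_ofPred, Finset.card_filter]
        push_cast
        refine Finset.sum_congr rfl fun i _ => ?_
        by_cases h : x (t i) = 0 <;> simp [h]
      rw [hcard]
      by_cases h : {i | (x ∘ t) i ≠ 0}.ncard ≤ n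
      · have := hsmall (x ∘ t) (fun i => (hx _).1) h
        have h2 : (0 : ℝ) ≤ ({i | (x ∘ t) i ≠ 0}.ncard : ℝ) / n := by positivity
        linarith
      · have h1 := sampleMean_nonneg ha0 hM (U := x ∘ t) fun i => (hx _).1
        have h2 : 1 ≤ ({i | (x ∘ t) i ≠ 0}.ncard : ℝ) / n := by
          rw [le_div_iff₀ hn0, one_mul]; exact_mod_cast (not_le.1 h).le
        linarith
    have h := Finset.sum_le_sum fun t (_ : t ∈ Finset.univ) =>
      mul_le_mul_of_nonneg_left (hle t) (hwα t)
    refine le_trans ?_ h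
    simp only [mul_sub]
    rw [Finset.sum_sub_distrib, ← Finset.sum_mul, sum_prod_eq_one hα]
    simp only [← mul_div_assoc]
    rw [← Finset.sum_div, sum_prod_mul_sum hα (4 * n) fun t => if x t = 0 then (0 : ℝ) else 1]
    have : ((4 * n : ℕ) : ℝ) * (∑ t, α t * if x t = 0 then (0 : ℝ) else 1) / n
        = 4 * ∑ t, α t * if x t = 0 then (0 : ℝ) else 1 := by push_cast; field_simp
    rw [this]
    linarith
  have hAβ : ∑ t : Fin (4 * n) → Option (Fin (K + 2)),
      (∏ i, β (t i)) * sampleMean a (4 * n) (x ∘ t) ≤ 1 / 3 + 2 / 100 := by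
    -- The same device for the total weight, whose mean is at most `8 * n` against the threshold
    -- `400 * n`. The product of the `β (t i)` is kept because the weights are at least `1` only
    -- where `β` is nonzero.
    have hle : ∀ t : Fin (4 * n) → Option (Fin (K + 2)),
        (∏ i, β (t i)) * sampleMean a (4 * n) (x ∘ t)
          ≤ (∏ i, β (t i)) * (1 / 3 + (∑ i, x (t i)) / (400 * n)) := by
      intro t
      by_cases h0 : ∏ i, β (t i) = 0
      · simp [h0]
      refine mul_le_mul_of_nonneg_left ?_ (hwβ t)
      have h1 : ∀ i, 1 ≤ (x ∘ t) i := fun i =>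
        hβx _ (Finset.prod_ne_zero_iff.1 h0 i (Finset.mem_univ i))
      have hs0 : 0 ≤ ∑ i, x (t i) := Finset.sum_nonneg fun i _ => (hx _).1
      by_cases h : ∑ i, (x ∘ t) i ≤ 400 * n
      · have h2 := hlarge (x ∘ t) h1 h
        have h3 : 0 ≤ (∑ i, x (t i)) / (400 * n) := by positivity
        linarith
      · have h2 := sampleMean_le_one ha1 hM (U := x ∘ t) fun i => (hx _).1
        have h3 : 1 ≤ (∑ i, x (t i)) / (400 * n) := by
          rw [le_div_iff₀ (by positivity), one_mul]; exact (not_le.1 h).le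
        linarith
    refine (Finset.sum_le_sum fun t _ => hle t).trans ?_
    simp only [mul_add]
    rw [Finset.sum_add_distrib, ← Finset.sum_mul, sum_prod_eq_one hβ]
    simp only [← mul_div_assoc]
    rw [← Finset.sum_div, sum_prod_mul_sum hβ (4 * n) x]
    have : ((4 * n : ℕ) : ℝ) * (∑ t, β t * x t) / (400 * n) = (∑ t, β t * x t) / 100 := by
      push_cast; field_simp; ring
    rw [this]
    linarith
  have := (abs_le.1 (hdiff.trans hsmallerr)).2
  -- The gap `(2 / 3 - 1 / 10) - (1 / 3 + 2 / 100)` exceeds `1 / 8`.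
  linarith

theorem exists_support_size_lower_bound :
    ∃ c : ℝ, 0 < c ∧ ∀ n : ℕ, 2 ≤ n → ∀ (m : ℕ) (a : (Fin m → Option (Fin (4 * n))) → ℝ),
      (∀ σ, 0 ≤ a σ) → (∀ σ, a σ ≤ 1) →
      (∀ U : Fin (4 * n) → ℝ, (∀ i, 0 ≤ U i) → {i | U i ≠ 0}.ncard ≤ n →
        2 / 3 ≤ sampleMean a (4 * n) U) →
      (∀ U : Fin (4 * n) → ℝ, (∀ i, 1 ≤ U i) → ∑ i, U i ≤ 400 * n →
        sampleMean a (4 * n) U ≤ 1 / 3) →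
      c * (n / Real.log n) ≤ m := by
  obtain ⟨N, hN⟩ := exists_forall_log_sq_le 1280000
  -- The first constant is `1280000` doubled by the passage from `Nat.log 2` to `Real.log`. The
  -- second makes the bound at most `1` for `n ≤ N`, where it suffices that `m ≠ 0`.
  refine ⟨min (1 / 2560000) (1 / (2 * N + 1)), by positivity, ?_⟩
  intro n hn m a ha0 ha1 hsmall hlarge
  have hn0 : (0 : ℝ) < n := by exact_mod_cast (by omega : 0 < n)
  have hlog2 : 1 / 2 < Real.log 2 := by linarith [Real.log_two_gt_d9]
  have hlog : Real.log 2 ≤ Real.log n := Real.log_le_log two_pos (by exact_mod_cast hn)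
  have hlog0 : 0 < Real.log n := by linarith
  rcases le_total N n with h | h
  · have hKlog := natLog_two_le_two_mul_log (by omega : n ≠ 0)
    have h1 := hN n h
    have hK : 320000 * (Nat.log 2 n : ℝ) ^ 2 ≤ n := by
      have : (Nat.log 2 n : ℝ) ^ 2 ≤ (2 * Real.log n) ^ 2 := by gcongr
      linarith
    have h2 := lt_of_separates hn ha0 ha1 hsmall hlarge hK
    calc _ ≤ 1 / 2560000 * (n / Real.log n) := by gcongr; exact min_le_left _ _
      _ ≤ m := by
        rw [← mul_div_assoc, div_le_iff₀ hlog0]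
        have : (m : ℝ) * (1280000 * Nat.log 2 n) ≤ m * (1280000 * (2 * Real.log n)) := by gcongr
        linarith
  · have hm : m ≠ 0 := by
      -- Without samples the acceptance probability does not depend on `U`, yet zero weights and
      -- unit weights demand different answers.
      rintro rfl
      have h1 := hsmall 0 (fun _ => le_rfl) (by simp)
      have h2 := hlarge 1 (fun _ => le_rfl) (by simp; linarith)
      simp [sampleMean] at h1 h2
      linarith
    have hm1 : (1 : ℝ) ≤ m := by exact_mod_cast Nat.one_le_iff_ne_zero.2 hm
    refine le_trans ?_ hm1
    have hnN : (n : ℝ) ≤ N := by exact_mod_cast h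
    calc _ ≤ 1 / (2 * N + 1 : ℝ) * (N / (1 / 2)) := by
          gcongr
          · exact min_le_right _ _
          · linarith
      _ ≤ 1 := by
          rw [one_div_mul_eq_div, div_le_one (by positivity)]
          linarith

/-! ### Halfspaces on the moment curve -/

/-- The point `(t, t², …, tⁿ)`. -/
def momentCurve (n : ℕ) (t : ℝ) : Fin n → ℝ := fun i => t ^ (i.1 + 1)

theorem momentCurve_injective {n : ℕ} (hn : 0 < n) : Function.Injective (momentCurve n) := by
  intro s t h
  simpa [momentCurve] using congrFun h ⟨0, hn⟩

theorem exists_halfspace_eq_on_momentCurve {n : ℕ} (s : Finset ℝ) (hs : s.card ≤ n + 1)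
    (label : ℝ → Bool) :
    ∃ h ∈ halfspaces n, ∀ t ∈ s, h (momentCurve n t) = label t := by
  classical
  set p := Lagrange.interpolate s id fun t => if label t then (1 : ℝ) else -1 with hp
  have hinj : Set.InjOn (id : ℝ → ℝ) (s : Set ℝ) := Function.injective_id.injOn
  have hdeg : p.natDegree < n + 1 := by
    rcases eq_or_ne p 0 with h0 | h0
    · simp [h0]
    · rw [Polynomial.natDegree_lt_iff_degree_lt h0]
      exact (Lagrange.degree_interpolate_lt _ hinj).trans_le (by exact_mod_cast hs)
  have heval : ∀ t, p.eval t = p.coeff 0 + ∑ i : Fin n, p.coeff (i.1 + 1) * momentCurve n t i := by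
    intro t
    rw [Polynomial.eval_eq_sum_range' hdeg, Finset.sum_range_succ', pow_zero, mul_one, add_comm,
      Finset.sum_range]
    rfl
  refine ⟨fun x => decide (0 ≤ p.coeff 0 + ∑ i : Fin n, p.coeff (i.1 + 1) * x i),
    ⟨p.coeff 0, fun i => p.coeff (i.1 + 1), fun x => by simp⟩, fun t ht => ?_⟩
  have hval : p.eval t = if label t then (1 : ℝ) else -1 :=
    Lagrange.eval_interpolate_at_node _ hinj ht
  simp only [← heval, hval]
  cases label t <;> norm_num

/-- Along the curve the halfspace is the sign of a polynomial of degree at most `n`, which has a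
root in each of the disjoint intervals `[2 * i, 2 * i + 1]` for `i ∈ T`. -/
theorem card_le_of_halfspace_alternates {n : ℕ} {h : (Fin n → ℝ) → Bool} (hh : h ∈ halfspaces n)
    (T : Finset ℕ) (hT : ∀ i ∈ T, h (momentCurve n (2 * i)) = true ∧
      h (momentCurve n (2 * i + 1)) = false) : T.card ≤ n := by
  classical
  obtain ⟨w₀, w, hw⟩ := hh
  set p : Polynomial ℝ := Polynomial.C w₀ +
    ∑ i : Fin n, Polynomial.C (w i) * Polynomial.X ^ (i.1 + 1) with hp
  have heval : ∀ t, p.eval t = w₀ + ∑ i, w i * momentCurve n t i := fun t => by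
    simp [hp, Polynomial.eval_finsetSum, momentCurve]
  have hdeg : p.natDegree ≤ n := by
    refine Polynomial.natDegree_add_le_of_degree_le (by simp) ?_
    refine Polynomial.natDegree_sum_le_of_forall_le _ _ fun i _ => ?_
    exact (Polynomial.natDegree_C_mul_X_pow_le _ _).trans i.2
  have hneg : ∀ i ∈ T, p.eval (2 * i + 1 : ℝ) < 0 := fun i hi => by
    rw [heval, ← not_le, ← hw, (hT i hi).2]; simp
  have hroot : ∀ i ∈ T, ∃ r : ℝ, 2 * i ≤ r ∧ r ≤ 2 * i + 1 ∧ p.eval r = 0 := fun i hi => by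
    have h1 : 0 ≤ p.eval (2 * i : ℝ) := by rw [heval, ← hw]; exact (hT i hi).1
    obtain ⟨r, hr, hr0⟩ := intermediate_value_Icc' (by linarith : (2 * i : ℝ) ≤ 2 * i + 1)
      p.continuous.continuousOn ⟨(hneg i hi).le, h1⟩
    exact ⟨r, hr.1, hr.2, hr0⟩
  choose! r hr using hroot
  rcases T.eq_empty_or_nonempty with rfl | ⟨i₀, hi₀⟩
  · simp
  have hp0 : p ≠ 0 := fun h0 => by simpa [h0] using hneg i₀ hi₀
  calc T.card = (T.image r).card := by
        refine (Finset.card_image_of_injOn fun i hi j hj hij => ?_).symm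
        have h1 := hr i hi
        have h2 := hr j hj
        rw [← hij] at h2
        have a1 : (i : ℝ) < j + 1 := by linarith
        have a2 : (j : ℝ) < i + 1 := by linarith
        have b1 : i < j + 1 := by exact_mod_cast a1
        have b2 : j < i + 1 := by exact_mod_cast a2
        omega
    _ ≤ p.roots.toFinset.card := by
        refine Finset.card_le_card fun x hx => ?_
        obtain ⟨i, hi, rfl⟩ := Finset.mem_image.1 hx
        rw [Multiset.mem_toFinset, Polynomial.mem_roots hp0]
        exact (hr i hi).2.2
    _ ≤ n := (Multiset.toFinset_card_le _).trans ((Polynomial.card_roots' p).trans hdeg)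

/-- Points on the moment curve: a dummy point and the points with parameters `0, 1, …, 4 n - 1`. -/
def curvePoint (n : ℕ) (c : Option (Fin (4 * n))) : Fin n → ℝ :=
  momentCurve n (c.elim (-1) fun i => i.1)

open Classical in
/-- The function that is `+1` exactly at the points of the moment curve with parameters
`0, 2, 4, …, 4 n - 2`. -/
noncomputable def alternatingLabel (n : ℕ) (x : Fin n → ℝ) : Bool :=
  decide (x ∈ (Finset.range (2 * n)).image fun i : ℕ => momentCurve n (2 * i))

theorem alternatingLabel_even {n i : ℕ} (hi : i < 2 * n) :
    alternatingLabel n (momentCurve n (2 * i)) = true := by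
  classical
  rw [alternatingLabel, decide_eq_true_iff]
  exact Finset.mem_image.2 ⟨i, Finset.mem_range.2 hi, rfl⟩

theorem alternatingLabel_odd {n : ℕ} (hn : 0 < n) (i : ℕ) :
    alternatingLabel n (momentCurve n (2 * i + 1)) = false := by
  classical
  rw [alternatingLabel, decide_eq_false_iff_not, Finset.mem_image]
  rintro ⟨j, -, hj⟩
  have h := momentCurve_injective hn hj
  have h' : 2 * j = 2 * i + 1 := by exact_mod_cast h
  omega

theorem exists_halfspace_eq_alternatingLabel {n : ℕ} {M : ℝ} {U : Fin (4 * n) → ℝ}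
    (hU : {i | U i ≠ 0}.ncard ≤ n) :
    ∃ h ∈ halfspaces n, ∀ c, sampleMass M U c ≠ 0 →
      h (curvePoint n c) = alternatingLabel n (curvePoint n c) := by
  classical
  -- The dummy point takes one of the `n + 1` interpolation nodes.
  set s : Finset ℝ := insert (-1) ((Finset.univ.filter fun i => U i ≠ 0).image
    fun i : Fin (4 * n) => (i.1 : ℝ)) with hs
  have hcard : s.card ≤ n + 1 := by
    rw [Set.ncard_eq_toFinset_card', Set.toFinset_ofPred] at hU
    exact (Finset.card_insert_le _ _).trans (Nat.succ_le_succ (Finset.card_image_le.trans hU))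
  obtain ⟨h, hh, heq⟩ := exists_halfspace_eq_on_momentCurve s hcard
    fun t => alternatingLabel n (momentCurve n t)
  refine ⟨h, hh, fun c hc => heq _ ?_⟩
  cases c with
  | none => simp [hs]
  | some i =>
    have : U i ≠ 0 := fun h0 => hc (by simp [sampleMass, h0])
    exact Finset.mem_insert_of_mem (Finset.mem_image.2 ⟨i, by simpa using this, rfl⟩)

theorem le_sum_sampleMass_ne_halfspace {n : ℕ} (hn : 0 < n) {U : Fin (4 * n) → ℝ}
    (hU : ∀ i, 1 ≤ U i) (hsum : ∑ i, U i ≤ 400 * n) {h : (Fin n → ℝ) → Bool}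
    (hh : h ∈ halfspaces n) :
    1 / 404 ≤ ∑ c with alternatingLabel n (curvePoint n c) ≠ h (curvePoint n c),
      sampleMass (4 * n) U c := by
  classical
  have hn0 : (0 : ℝ) < n := by exact_mod_cast hn
  have hU0 : ∀ i, 0 ≤ U i := fun i => zero_le_one.trans (hU i)
  have hs0 : 0 ≤ ∑ i, U i := Finset.sum_nonneg fun i _ => hU0 i
  set bad : Finset (Fin (4 * n)) := Finset.univ.filter fun i =>
    alternatingLabel n (curvePoint n (some i)) ≠ h (curvePoint n (some i)) with hbad
  set T : Finset ℕ := (Finset.range (2 * n)).filter fun i =>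
    h (momentCurve n (2 * i)) = true ∧ h (momentCurve n (2 * i + 1)) = false with hT
  have hTn : T.card ≤ n :=
    card_le_of_halfspace_alternates hh T fun i hi => (Finset.mem_filter.1 hi).2
  -- A pair `2 * i`, `2 * i + 1` on which `h` fails to alternate contains an error, and halving
  -- recovers the pair. At least `n` of the `2 * n` pairs fail.
  have hsub : Finset.range (2 * n) \ T ⊆ bad.image fun j => j.1 / 2 := by
    intro i hi
    obtain ⟨hi1, hi2⟩ := Finset.mem_sdiff.1 hi
    have hi3 := Finset.mem_range.1 hi1
    have hi4 : ¬(h (momentCurve n (2 * i)) = true ∧ h (momentCurve n (2 * i + 1)) = false) :=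
      fun hc => hi2 (Finset.mem_filter.2 ⟨hi1, hc⟩)
    rw [Finset.mem_image]
    by_cases he : h (momentCurve n (2 * i)) = true
    · refine ⟨⟨2 * i + 1, by omega⟩, Finset.mem_filter.2 ⟨Finset.mem_univ _, ?_⟩, by simp; omega⟩
      have : curvePoint n (some ⟨2 * i + 1, by omega⟩) = momentCurve n (2 * i + 1) := by
        simp [curvePoint]
      rw [this, alternatingLabel_odd hn]
      exact fun hc => hi4 ⟨he, hc.symm⟩
    · refine ⟨⟨2 * i, by omega⟩, Finset.mem_filter.2 ⟨Finset.mem_univ _, ?_⟩, by simp⟩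
      have : curvePoint n (some ⟨2 * i, by omega⟩) = momentCurve n (2 * i) := by
        simp [curvePoint]
      rw [this, alternatingLabel_even hi3]
      exact fun hc => he hc.symm
  have hbadn : n ≤ bad.card := by
    have h1 := (Finset.card_le_card hsub).trans Finset.card_image_le
    have h2 := Finset.le_card_sdiff T (Finset.range (2 * n))
    rw [Finset.card_range] at h2
    omega
  have hbadn' : (n : ℝ) ≤ bad.card := by exact_mod_cast hbadn
  calc (1 / 404 : ℝ) = n * (1 / (404 * n)) := by field_simp
    _ ≤ bad.card * (1 / (404 * n)) := by gcongr
    _ = ∑ _i ∈ bad, (1 / (404 * n) : ℝ) := by rw [Finset.sum_const, nsmul_eq_mul]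
    _ ≤ ∑ i ∈ bad, sampleMass (4 * n) U (some i) := by
        refine Finset.sum_le_sum fun i _ => ?_
        simp only [sampleMass, Option.elim]
        -- The normalizer is at most `4 * n + 400 * n`, so every point has mass at least `1 / (404 *
        -- n)`.
        exact div_le_div₀ (hU0 i) (hU i) (by linarith) (by linarith)
    _ = ∑ c ∈ bad.map Function.Embedding.some, sampleMass (4 * n) U c := by
        rw [Finset.sum_map]; rfl
    _ ≤ _ := by
        refine Finset.sum_le_sum_of_subset_of_nonneg (fun c hc => ?_) fun c _ _ =>
          sampleMass_nonneg (by positivity) hU0 c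
        obtain ⟨i, hi, rfl⟩ := Finset.mem_map.1 hc
        exact Finset.mem_filter.2 ⟨Finset.mem_univ _, (Finset.mem_filter.1 hi).2⟩

theorem measurable_of_mem_halfspaces {n : ℕ} {𝓜 : MeasurableSpace (Fin n → ℝ)}
    (h𝓜 : borel (Fin n → ℝ) ≤ 𝓜) {h : (Fin n → ℝ) → Bool} (hh : h ∈ halfspaces n) :
    Measurable[𝓜] h := by
  obtain ⟨w₀, w, hw⟩ := hh
  refine measurable_to_bool ?_
  have hclosed : IsClosed {x : Fin n → ℝ | 0 ≤ w₀ + ∑ i, w i * x i} :=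
    isClosed_le continuous_const (by fun_prop)
  have : h ⁻¹' {true} = {x : Fin n → ℝ | 0 ≤ w₀ + ∑ i, w i * x i} := by
    ext x; exact hw x
  rw [this]
  exact h𝓜 _ (MeasurableSpace.measurableSet_generateFrom hclosed.isOpen_compl).of_compl

theorem measurable_alternatingLabel {n : ℕ} {𝓜 : MeasurableSpace (Fin n → ℝ)}
    (h𝓜 : borel (Fin n → ℝ) ≤ 𝓜) : Measurable[𝓜] (alternatingLabel n) := by
  classical
  refine measurable_to_bool ?_
  set s := (Finset.range (2 * n)).image fun i : ℕ => momentCurve n (2 * i)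
  have : alternatingLabel n ⁻¹' {true} = (s : Set (Fin n → ℝ)) := by
    ext x; simp [alternatingLabel, s]
  rw [this]
  exact h𝓜 _ (MeasurableSpace.measurableSet_generateFrom
    s.finite_toSet.isClosed.isOpen_compl).of_compl

/-! ### Finitely supported distributions -/

/-- The law of `x c` when `c` has law `P`. -/
noncomputable def PMF.pointLaw {C X : Type*} (P : PMF C) (𝓜 : MeasurableSpace X) (x : C → X) :
    Measure X :=
  letI : MeasurableSpace C := ⊤
  P.toMeasure.map x

namespace PMF

variable {C X : Type*} [Fintype C] {𝓜 : MeasurableSpace X} (P : PMF C) (x : C → X)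

instance : IsProbabilityMeasure (P.pointLaw 𝓜 x) := by
  let _ : MeasurableSpace C := ⊤
  exact Measure.isProbabilityMeasure_map measurable_from_top.aemeasurable

-- As a lower bound this needs no measurability of `S`, so it applies to any disagreement set.
open Classical in
theorem sum_le_pointLaw (S : Set X) : ∑ c with x c ∈ S, P c ≤ P.pointLaw 𝓜 x S := by
  let _ : MeasurableSpace C := ⊤
  refine le_trans (le_of_eq ?_) (Measure.le_map_apply measurable_from_top.aemeasurable S)
  rw [PMF.toMeasure_apply_fintype, Finset.sum_filter]
  rfl

theorem pointLaw_eq_zero {S : Set X} (hS : MeasurableSet S) (h : ∀ c, x c ∈ S → P c = 0) :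
    P.pointLaw 𝓜 x S = 0 := by
  let _ : MeasurableSpace C := ⊤
  rw [pointLaw, Measure.map_apply measurable_from_top hS, PMF.toMeasure_apply_fintype]
  exact Finset.sum_eq_zero fun c _ => Set.indicator_apply_eq_zero.2 (h c)

theorem prod_pi_pointLaw {Ω : Type*} [MeasurableSpace Ω] (ρ : Measure Ω) [IsProbabilityMeasure ρ]
    {m : ℕ} {E : Set (Ω × (Fin m → X))} (hE : MeasurableSet E) :
    (ρ.prod (Measure.pi fun _ : Fin m => P.pointLaw 𝓜 x)) E
      = ∑ σ : Fin m → C, ρ {ω | (ω, fun i => x (σ i)) ∈ E} * ∏ i, P (σ i) := by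
  classical
  let _ : MeasurableSpace C := ⊤
  have hx : Measurable x := measurable_from_top
  have hprob : IsProbabilityMeasure (P.toMeasure.map x) :=
    Measure.isProbabilityMeasure_map hx.aemeasurable
  have hσ : Measurable fun (σ : Fin m → C) i => x (σ i) :=
    measurable_pi_lambda _ fun i => hx.comp (measurable_pi_apply i)
  rw [Measure.prod_apply_symm hE]
  simp only [pointLaw]
  rw [← Measure.pi_map_pi fun _ => hx.aemeasurable, lintegral_map
    (measurable_measure_prodMk_right hE) hσ, lintegral_fintype]
  refine Finset.sum_congr rfl fun σ _ => ?_
  rw [Measure.pi_singleton]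
  simp only [PMF.toMeasure_apply_singleton _ _ (MeasurableSet.singleton _)]
  rfl

end PMF

/-- `sampleMass M U` as a probability mass function. -/
noncomputable def samplePMF {k : ℕ} {M : ℝ} (hM : 0 < M) {U : Fin k → ℝ} (hU : ∀ i, 0 ≤ U i) :
    PMF (Option (Fin k)) :=
  PMF.ofFintype (fun c => ENNReal.ofReal (sampleMass M U c)) <| by
    rw [← ENNReal.ofReal_sum_of_nonneg fun c _ => sampleMass_nonneg hM hU c, sum_sampleMass hM hU,
      ENNReal.ofReal_one]

section

variable {X Ω : Type*} {𝓜 : MeasurableSpace X} [MeasurableSpace Ω] {ρ : Measure Ω}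
  [IsProbabilityMeasure ρ] {k m : ℕ} {M : ℝ} {U : Fin k → ℝ}

/-- Integrating out the seed first leaves a `[0, 1]`-valued function of the sampled indices. `G`
stands for a run of either kind of algorithm on a fixed label function. -/
theorem measureReal_eq_sampleMean (hM : 0 < M) (hU : ∀ i, 0 ≤ U i) (x : Option (Fin k) → X)
    {G : Ω × (Fin m → X) → Bool} (hG : Measurable G) (b : Bool) :
    (ρ.prod (Measure.pi fun _ : Fin m => (samplePMF hM hU).pointLaw 𝓜 x)).real {p | G p = b}
      = sampleMean (fun σ => ρ.real {ω | G (ω, fun i => x (σ i)) = b}) M U := by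
  have hE : MeasurableSet {p | G p = b} := hG (measurableSet_singleton b)
  rw [measureReal_def, PMF.prod_pi_pointLaw _ _ _ hE,
    ENNReal.toReal_sum fun σ _ => ENNReal.mul_ne_top (measure_ne_top _ _)
      (ENNReal.prod_ne_top fun i _ => PMF.apply_ne_top _ _)]
  refine Finset.sum_congr rfl fun σ _ => ?_
  rw [ENNReal.toReal_mul, ENNReal.toReal_prod, mul_comm]
  congr 1
  refine Finset.prod_congr rfl fun i _ => ?_
  rw [samplePMF, PMF.ofFintype_apply, ENNReal.toReal_ofReal (sampleMass_nonneg hM hU _)]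

theorem two_thirds_le_measureReal {μ : Measure Ω} [IsFiniteMeasure μ] {S : Set Ω}
    (h : 2 / 3 ≤ μ S) : 2 / 3 ≤ μ.real S := by
  have := ENNReal.toReal_mono (measure_ne_top μ S) h
  simpa [measureReal_def] using this

theorem measureReal_eq_true_le {μ : Measure Ω} [IsProbabilityMeasure μ] {G : Ω → Bool}
    (hG : Measurable G) (h : 2 / 3 ≤ μ {p | G p = false}) : μ.real {p | G p = true} ≤ 1 / 3 := by
  have hc : {p | G p = true} = {p | G p = false}ᶜ := by ext p; simp
  have hE : MeasurableSet {p | G p = false} := hG (measurableSet_singleton false)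
  rw [hc, probReal_compl_eq_one_sub hE]
  linarith [two_thirds_le_measureReal h]

end

/-! ### Distances to halfspaces -/

theorem distToClass_halfspaces_ge {n : ℕ} (hn : 0 < n) {𝓜 : MeasurableSpace (Fin n → ℝ)}
    (hM : (0 : ℝ) < 4 * n) {U : Fin (4 * n) → ℝ} (hU0 : ∀ i, 0 ≤ U i)
    (hU : ∀ i, 1 ≤ U i) (hsum : ∑ i, U i ≤ 400 * n) :
    ENNReal.ofReal (1 / 404) ≤
      distToClass ((samplePMF hM hU0).pointLaw 𝓜 (curvePoint n)) (alternatingLabel n)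
        (halfspaces n) := by
  classical
  refine le_iInf₂ fun h hh => ?_
  refine le_trans ?_ (PMF.sum_le_pointLaw _ _ _)
  simp only [samplePMF, PMF.ofFintype_apply]
  rw [← ENNReal.ofReal_sum_of_nonneg fun c _ => sampleMass_nonneg hM hU0 c]
  exact ENNReal.ofReal_le_ofReal (by convert le_sum_sampleMass_ne_halfspace hn hU hsum hh)

theorem labelDist_eq_zero {n : ℕ} {𝓜 : MeasurableSpace (Fin n → ℝ)}
    (hM : (0 : ℝ) < 4 * n) {U : Fin (4 * n) → ℝ} (hU0 : ∀ i, 0 ≤ U i)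
    {f h : (Fin n → ℝ) → Bool} (hf : Measurable[𝓜] f) (hh : Measurable[𝓜] h)
    (heq : ∀ c, sampleMass (4 * n) U c ≠ 0 → h (curvePoint n c) = f (curvePoint n c)) :
    labelDist ((samplePMF hM hU0).pointLaw 𝓜 (curvePoint n)) f h = 0 := by
  refine PMF.pointLaw_eq_zero _ _ (measurableSet_eq_fun hf hh).compl fun c hc => ?_
  rw [samplePMF, PMF.ofFintype_apply]
  by_contra h0
  refine hc (heq c fun h1 => h0 ?_).symm
  rw [h1, ENNReal.ofReal_zero]

/-! ### Measurability of the interaction -/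

theorem measurable_snoc {Z X : Type*} [MeasurableSpace Z] [MeasurableSpace X] {i : ℕ}
    {g : Z → Fin i → X} {y : Z → X} (hg : Measurable g) (hy : Measurable y) :
    Measurable fun z => (Fin.snoc (g z) (y z) : Fin (i + 1) → X) := by
  refine measurable_pi_lambda _ fun j => ?_
  refine Fin.lastCases ?_ (fun j => ?_) j
  · simpa only [Fin.snoc_last] using hy
  · simpa only [Fin.snoc_castSucc, Function.comp_def] using (measurable_pi_apply j).comp hg

theorem QueryAlgorithm.measurable_answers {X : Type*} {𝓜 : MeasurableSpace X} {q : ℕ}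
    (A : QueryAlgorithm 𝓜 q) {f : X → Bool} (hf : Measurable f) (i : ℕ) (hi : i ≤ q) :
    Measurable fun p : A.Ω × (Fin q → X) => A.answers f p.1 p.2 i hi := by
  induction i with
  | zero => exact measurable_pi_lambda _ fun j => j.elim0
  | succ i ih =>
    have hpast := measurable_fst.prodMk (ih (Nat.le_of_succ_le hi))
    have hpoint : Measurable fun p : A.Ω × (Fin q → X) =>
        A.point p.1 (A.answers f p.1 p.2 i (Nat.le_of_succ_le hi)) (p.2 ⟨i, hi⟩) :=
      Measurable.ite
        (((A.measurable_wantsSample i).comp hpast) (measurableSet_singleton true))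
        ((measurable_pi_apply _).comp measurable_snd)
        ((A.measurable_queryPoint i).comp hpast)
    exact measurable_snoc (ih (Nat.le_of_succ_le hi)) (hpoint.prodMk (hf.comp hpoint))

theorem SampleAlgorithm.measurable_run {X : Type*} {𝓜 : MeasurableSpace X} {m : ℕ}
    (A : SampleAlgorithm 𝓜 m) {f : X → Bool} (hf : Measurable f) :
    Measurable fun p : A.Ω × (Fin m → X) => A.output (p.1, fun i => (p.2 i, f (p.2 i))) :=
  A.measurable_output.comp <| measurable_fst.prodMk <| measurable_pi_lambda _ fun i =>
    have hi : Measurable fun p : A.Ω × (Fin m → X) => p.2 i :=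
      (measurable_pi_apply i).comp measurable_snd
    hi.prodMk (hf.comp hi)

theorem QueryAlgorithm.measurable_run {X : Type*} {𝓜 : MeasurableSpace X} {q : ℕ}
    (A : QueryAlgorithm 𝓜 q) {f : X → Bool} (hf : Measurable f) :
    Measurable fun p : A.Ω × (Fin q → X) => A.output (p.1, A.answers f p.1 p.2 q le_rfl) :=
  A.measurable_output.comp (measurable_fst.prodMk (A.measurable_answers hf q le_rfl))

/-! ### The lower bounds -/

theorem ENNReal.ofReal_le_iInf_natCast {p : ℕ → Prop} {r : ℝ} (h : ∀ m, p m → r ≤ m) :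
    ENNReal.ofReal r ≤ ((⨅ (m : ℕ) (_ : p m), (m : ℕ∞) : ℕ∞) : ℝ≥0∞) := by
  have h1 : ((⌈r⌉₊ : ℕ) : ℕ∞) ≤ ⨅ (m : ℕ) (_ : p m), (m : ℕ∞) :=
    le_iInf₂ fun m hm => by exact_mod_cast Nat.ceil_le.2 (h m hm)
  calc ENNReal.ofReal r ≤ ((⌈r⌉₊ : ℕ) : ℝ≥0∞) := by
        rw [← ENNReal.ofReal_natCast]; exact ENNReal.ofReal_le_ofReal (Nat.le_ceil r)
    _ = (((⌈r⌉₊ : ℕ) : ℕ∞) : ℝ≥0∞) := by simp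
    _ ≤ _ := ENat.toENNReal_mono h1

theorem mainTheorem4 :
    ∃ ε₀ : ℝ, 0 < ε₀ ∧ ∃ c : ℝ, 0 < c ∧
      ∀ ε : ℝ, 0 < ε → ε < ε₀ →
      ∀ n : ℕ, 2 ≤ n →
      ∀ 𝓜 : MeasurableSpace (Fin n → ℝ), borel (Fin n → ℝ) ≤ 𝓜 →
        ENNReal.ofReal (c * (n / Real.log n)) ≤
            (testSampleComplexity 𝓜 ε (halfspaces n) : ℝ≥0∞) ∧
        ENNReal.ofReal (c * (n / Real.log n)) ≤
            (tolerantQueryComplexity 𝓜 0 ε (halfspaces n) : ℝ≥0∞) := by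
  obtain ⟨c, hc, hbound⟩ := exists_support_size_lower_bound
  refine ⟨1 / 404, by norm_num, c, hc, fun ε hε hε₀ n hn 𝓜 h𝓜 => ?_⟩
  have hn0 : 0 < n := by omega
  have hM : (0 : ℝ) < 4 * n := by positivity
  have hf : Measurable[𝓜] (alternatingLabel n) := measurable_alternatingLabel h𝓜
  have hεlt : ENNReal.ofReal ε < ENNReal.ofReal (1 / 404) :=
    (ENNReal.ofReal_lt_ofReal_iff (by norm_num)).2 hε₀
  refine ⟨ENNReal.ofReal_le_iInf_natCast fun m ⟨A, hA⟩ => ?_,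
    ENNReal.ofReal_le_iInf_natCast fun q ⟨A, hA⟩ => ?_⟩
  · refine hbound n hn m (fun σ => A.ρ.real {ω | A.output (ω, fun i => (curvePoint n (σ i),
      alternatingLabel n (curvePoint n (σ i)))) = true}) (fun σ => measureReal_nonneg)
      (fun σ => measureReal_le_one) (fun U hU hcard => ?_) (fun U hU hsum => ?_)
    · obtain ⟨h, hh, heq⟩ := exists_halfspace_eq_alternatingLabel (M := 4 * n) hcard
      have hhm := measurable_of_mem_halfspaces h𝓜 hh
      have h1 := two_thirds_le_measureReal
        ((hA ((samplePMF hM hU).pointLaw 𝓜 (curvePoint n)) h hhm).1 hh)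
      rw [measureReal_eq_sampleMean hM hU (curvePoint n) (A.measurable_run hhm)] at h1
      -- The tester must accept the halfspace `h`. On sample sequences of nonzero probability it
      -- sees the labels of `alternatingLabel n`, so it accepts that function equally often.
      refine h1.trans_eq (Finset.sum_congr rfl fun σ _ => ?_)
      by_cases h0 : ∏ i, sampleMass (4 * n) U (σ i) = 0
      · rw [h0, zero_mul, zero_mul]
      · simp only [fun i => heq (σ i) (Finset.prod_ne_zero_iff.1 h0 i (Finset.mem_univ i))]
    · have hU0 : ∀ i, 0 ≤ U i := fun i => zero_le_one.trans (hU i)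
      have h1 := measureReal_eq_true_le (A.measurable_run hf)
        ((hA ((samplePMF hM hU0).pointLaw 𝓜 (curvePoint n)) _ hf).2
          (hεlt.trans_le (distToClass_halfspaces_ge hn0 hM hU0 hU hsum)))
      rwa [measureReal_eq_sampleMean hM hU0 (curvePoint n) (A.measurable_run hf)] at h1
  -- Queries off the support could distinguish `h` from `alternatingLabel n`, so both cases use the
  -- latter; tolerance at distance `0` forces acceptance in the small case. With the labels fixed,
  -- the transcript is a function of the seed and the samples alone.
  · refine hbound n hn q (fun σ => A.ρ.real {ω | A.output (ω, A.answers (alternatingLabel n) ω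
      (fun i => curvePoint n (σ i)) q le_rfl) = true}) (fun σ => measureReal_nonneg)
      (fun σ => measureReal_le_one) (fun U hU hcard => ?_) (fun U hU hsum => ?_)
    · obtain ⟨h, hh, heq⟩ := exists_halfspace_eq_alternatingLabel (M := 4 * n) hcard
      have hdist := labelDist_eq_zero hM hU hf (measurable_of_mem_halfspaces h𝓜 hh) heq
      have h1 := two_thirds_le_measureReal
        ((hA ((samplePMF hM hU).pointLaw 𝓜 (curvePoint n)) _ hf).1
          ((iInf₂_le h hh).trans (by rw [hdist]; exact zero_le)))
      rwa [measureReal_eq_sampleMean hM hU (curvePoint n) (A.measurable_run hf)] at h1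
    · have hU0 : ∀ i, 0 ≤ U i := fun i => zero_le_one.trans (hU i)
      have h1 := measureReal_eq_true_le (A.measurable_run hf)
        ((hA ((samplePMF hM hU0).pointLaw 𝓜 (curvePoint n)) _ hf).2
          (hεlt.le.trans (distToClass_halfspaces_ge hn0 hM hU0 hU hsum)))
      rwa [measureReal_eq_sampleMean hM hU0 (curvePoint n) (A.measurable_run hf)] at h1
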